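/- Let $a\in W^{1,\infty}(\mathbb S^1,\mathbb R)$ and let $\mathbf A\in W^{1,\infty}(\mathbb S^1,\mathbb R^2)$ be a transversal field, $\mathbf A(\omega)\cdot\omega=0$ for all $\omega\in\mathbb S^1$ (Lipschitz representatives are used). Put $A(\theta)=\mathbf A(\cos\theta,\sin\theta)\cdot(-\sin\theta,\cos\theta)$, $\widetilde A=\frac1{2\pi}\int_0^{2\pi}A(s)\,ds$, $\widetilde a=\frac1{2\pi}\int_0^{2\pi}a(\cos s,\sin s)\,ds$, and assume $\widetilde A\notin\frac12\mathbb Z$. Identify functions on $\mathbb S^1$ with $2\pi$-periodic functions of $\theta$. The operator $L_{\mathbf A,a}=(-i\nabla_{\mathbb S^1}+\mathbf A)^2+a$ on $\mathbb S^1$ has real eigenvalues $\mu_1\le\mu_2\le\cdots\to+\infty$, each repeated according to its finite multiplicity, and there exist $k^*,\ell\in\mathbb N$, real numbers $\lambda_j$, functions $\phi_j$ on $\mathbb S^1$ and functions $R_j:\mathbb R\to\mathbb C$ ($j\in\mathbb Z$, $|j|\ge\ell$) such that: (i) $\{\mu_k:k>k^*\}=\{\lambda_j:|j|\ge\ell\}$,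 where the $\mu_k$ with $k>k^*$ are pairwise distinct and the $\lambda_j$ with $|j|\ge\ell$ are pairwise distinct; (ii) as $|j|\to\infty$, $\sqrt{\lambda_j-\widetilde a}=(\operatorname{sgn}j)\big(\widetilde A-\lfloor\widetilde A+\tfrac12\rfloor\big)+|j|+O(|j|^{-3})$ and $\lambda_j=\widetilde a+\big(j+\widetilde A-\lfloor\widetilde A+\tfrac12\rfloor\big)^2+O(j^{-2})$; (iii) for $|j|\ge\ell$, $\phi_j$ is an $L^2(\mathbb S^1)$-normalized eigenfunction of $L_{\mathbf A,a}$ for $\lambda_j$, and for all $\theta\in\mathbb R$ $$\phi_j(\theta)=\tfrac1{\sqrt{2\pi}}\,e^{-i\left(\lfloor\widetilde A+1/2\rfloor\theta+\int_0^\theta A(t)\,dt\right)}\big(e^{i(\widetilde A+j)\theta}+R_j(\theta)\big),\qquad \sup_{\theta}|R_j(\theta)|=O(|j|^{-1})\ \text{ as }|j|\to\infty.$$ Moreover, assume $\mu_1>0$ and let $k^*,\ell,\lambda_j,\phi_j,R_j$ be any data satisfying (i)-(iii). For $k\le k^*$ let $\psi_k$ be any $L^2(\mathbb S^1)$-normalized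 eigenfunction of $L_{\mathbf A,a}$ for $\mu_k$, and for $k>k^*$ let $\psi_k=\phi_j$, where $\mu_k=\lambda_j$. Define $$K(x,y)=\sum_{k=1}^\infty i^{-\sqrt{\mu_k}}J_{\sqrt{\mu_k}}(|x||y|)\,\psi_k\big(\tfrac{x}{|x|}\big)\overline{\psi_k\big(\tfrac{y}{|y|}\big)},\qquad i^{-\beta}=e^{-i\pi\beta/2},$$ where $J_\nu$ is the Bessel function of the first kind (all terms vanish if $x=0$ or $y=0$). Then for all $r,r'\ge0$ and $\theta,\theta'\in\mathbb R$, with $x=(r\cos\theta,r\sin\theta)$ and $y=(r'\cos\theta',r'\sin\theta')$, the series defining $K(x,y)$ and the series below converge absolutely, and $$K(x,y)=\sum_{k=1}^{k^*}i^{-\sqrt{\mu_k}}J_{\sqrt{\mu_k}}(rr')\psi_k(\theta)\overline{\psi_k(\theta')}$$ $$\quad+\frac1{2\pi}\,e^{-i\int_{\theta'}^{\theta}A(s)\,ds}\,e^{-i\lfloor\widetilde A+\frac12\rfloor(\theta-\theta')}\sum_{|j|\ge\ell}i^{-\sqrt{\lambda_j}}J_{\sqrt{\lambda_j}}(rr')\big(e^{i(\widetilde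 A+j)\theta}+R_j(\theta)\big)\big(e^{-i(\widetilde A+j)\theta'}+\overline{R_j(\theta')}\big).$$ -/

import Mathlib

open scoped ComplexConjugate
open Asymptotics Filter

noncomputable section

/-- The Euclidean plane `ℝ²`. -/
abbrev Plane : Type := EuclideanSpace ℝ (Fin 2)

/-- The unit circle `𝕊¹ ⊂ ℝ²`. -/
abbrev UnitCircle : Type := Metric.sphere (0 : Plane) 1

/-- The point `(cos θ, sin θ)` of `𝕊¹`. -/
def pt (θ : ℝ) : UnitCircle :=
  ⟨!₂[Real.cos θ, Real.sin θ], by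
    simp [EuclideanSpace.norm_eq]⟩

/-- The unit tangent vector `(-sin θ, cos θ)` at `(cos θ, sin θ)`. -/
def tangent (θ : ℝ) : Plane := !₂[-Real.sin θ, Real.cos θ]

/-- `A(θ) = Avec(cos θ, sin θ) · (-sin θ, cos θ)`. -/
def angularComponent (Avec : UnitCircle → Plane) (θ : ℝ) : ℝ :=
  inner ℝ (Avec (pt θ)) (tangent θ)

/-- The average `(2π)⁻¹ ∫₀^{2π} f(s) ds`. -/
def average (f : ℝ → ℝ) : ℝ := (1 / (2 * Real.pi)) * ∫ s in (0 : ℝ)..(2 * Real.pi), f s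

/-- The average `Ã` of the angular component of `Avec`. -/
def avgA (Avec : UnitCircle → Plane) : ℝ := average (angularComponent Avec)

/-- `ã`, the average of `a` over the circle. -/
def avga (a : UnitCircle → ℝ) : ℝ := average (fun θ => a (pt θ))

/-- The magnetic derivative `-i f' + A f`, in the angular variable. -/
def magneticDeriv (A : ℝ → ℝ) (f : ℝ → ℂ) (θ : ℝ) : ℂ :=
  -Complex.I * deriv f θ + (A θ : ℂ) * f θ

/-- `ψ` solves `(-i ∇_{𝕊¹} + Avec)² ψ + a ψ = μ ψ` on `𝕊¹`, where `Avec` is a tangential field. For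
Lipschitz `Avec` and `a`, every weak solution in `H¹(𝕊¹)` has `ψ` and `(-i ∇ + Avec) ψ` of class `C¹`,
so that the equation holds at every point. -/
def SolvesEigenEq (Avec : UnitCircle → Plane) (a : UnitCircle → ℝ) (μ : ℝ) (ψ : UnitCircle → ℂ) :
    Prop :=
  Differentiable ℝ (fun θ => ψ (pt θ)) ∧
  Differentiable ℝ (magneticDeriv (angularComponent Avec) (fun θ => ψ (pt θ))) ∧
  ∀ θ : ℝ,
    magneticDeriv (angularComponent Avec)
        (magneticDeriv (angularComponent Avec) (fun s => ψ (pt s))) θ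
      + (a (pt θ) : ℂ) * ψ (pt θ) = (μ : ℂ) * ψ (pt θ)

theorem magneticDeriv_add {A : ℝ → ℝ} {f g : ℝ → ℂ} (hf : Differentiable ℝ f)
    (hg : Differentiable ℝ g) :
    magneticDeriv A (fun θ => f θ + g θ)
      = fun θ => magneticDeriv A f θ + magneticDeriv A g θ := by
  funext θ
  simp only [magneticDeriv]
  rw [deriv_fun_add (hf θ) (hg θ)]
  ring

theorem magneticDeriv_mul {A : ℝ → ℝ} {f : ℝ → ℂ} (c : ℂ) (hf : Differentiable ℝ f) :
    magneticDeriv A (fun θ => c * f θ) = fun θ => c * magneticDeriv A f θ := by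
  funext θ
  simp only [magneticDeriv]
  rw [deriv_const_mul c (hf θ)]
  ring

/-- The eigenspace of `L_{Avec,a} = (-i ∇_{𝕊¹} + Avec)² + a` for the number `μ`
(zero when `μ` is not an eigenvalue). -/
def eigenspaceL (Avec : UnitCircle → Plane) (a : UnitCircle → ℝ) (μ : ℝ) :
    Submodule ℂ (UnitCircle → ℂ) where
  carrier := {ψ | SolvesEigenEq Avec a μ ψ}
  zero_mem' := by
    have h : magneticDeriv (angularComponent Avec) (fun _ : ℝ => (0 : ℂ)) = fun _ => 0 := by
      funext θ; simp [magneticDeriv]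
    refine ⟨by simp, ?_, ?_⟩
    · simp only [Pi.zero_apply, h]
      exact differentiable_const _
    · intro θ
      simp [h]
  add_mem' := by
    rintro f g ⟨hf, hf', ef⟩ ⟨hg, hg', eg⟩
    have h := magneticDeriv_add (A := angularComponent Avec) hf hg
    refine ⟨by simpa using hf.fun_add hg, ?_, ?_⟩
    · simp only [Pi.add_apply, h]
      exact hf'.fun_add hg'
    · intro θ
      simp only [Pi.add_apply, h]
      rw [magneticDeriv_add hf' hg']
      linear_combination ef θ + eg θ
  smul_mem' := by
    rintro c f ⟨hf, hf', ef⟩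
    have h := magneticDeriv_mul (A := angularComponent Avec) c hf
    refine ⟨by simpa using hf.const_mul c, ?_, ?_⟩
    · simp only [Pi.smul_apply, smul_eq_mul, h]
      exact hf'.const_mul c
    · intro θ
      simp only [Pi.smul_apply, smul_eq_mul, h]
      rw [magneticDeriv_mul c hf']
      linear_combination c * ef θ

/-- `ψ` is an `L²(𝕊¹)`-normalized eigenfunction of `L_{Avec,a}` for the eigenvalue `μ`. -/
def IsNormalizedEigenfunction (Avec : UnitCircle → Plane) (a : UnitCircle → ℝ) (μ : ℝ)
    (ψ : UnitCircle → ℂ) : Prop :=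
  ψ ∈ eigenspaceL Avec a μ ∧ ∫ θ in (0 : ℝ)..(2 * Real.pi), ‖ψ (pt θ)‖ ^ 2 = 1

/-- `μ 0 ≤ μ 1 ≤ μ 2 ≤ ⋯ → ∞` are the eigenvalues of `L_{Avec,a}`, each repeated according to its
finite multiplicity. The term `μ k` is the eigenvalue usually written `μ_{k+1}`. -/
structure IsEigenvalueSequence (Avec : UnitCircle → Plane) (a : UnitCircle → ℝ) (μ : ℕ → ℝ) :
    Prop where
  mono : Monotone μ
  tendsto : Tendsto μ atTop atTop
  finite : ∀ t : ℝ, Module.Finite ℂ (eigenspaceL Avec a t)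
  mult : ∀ t : ℝ, {k : ℕ | μ k = t}.ncard = Module.finrank ℂ (eigenspaceL Avec a t)

/-- The description of the large eigenvalues of `L_{Avec,a}`: up to finitely many of them (`kstar` in
number), the eigenvalues are the numbers `lam j`, `|j| ≥ ℓ`, each occurring once, with normalized
eigenfunctions `φ j` and remainders `R j`, and with the stated asymptotics as `|j| → ∞`. -/
structure IsHighSpectrum (Avec : UnitCircle → Plane) (a : UnitCircle → ℝ) (μ : ℕ → ℝ)
    (kstar ℓ : ℕ) (lam : ℤ → ℝ) (φ : ℤ → UnitCircle → ℂ) (R : ℤ → ℝ → ℂ) : Prop where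
  image_eq : μ '' {k | kstar ≤ k} = lam '' {j | (ℓ : ℤ) ≤ |j|}
  injOn_mu : Set.InjOn μ {k | kstar ≤ k}
  injOn_lam : Set.InjOn lam {j | (ℓ : ℤ) ≤ |j|}
  sqrt_asymp :
    (fun j : ℤ => √(lam j - avga a)
        - ((Int.sign j : ℝ) * (avgA Avec - (⌊avgA Avec + 1 / 2⌋ : ℝ)) + |(j : ℝ)|))
      =O[cofinite] fun j : ℤ => 1 / |(j : ℝ)| ^ 3
  asymp :
    (fun j : ℤ => lam j
        - (avga a + ((j : ℝ) + avgA Avec - (⌊avgA Avec + 1 / 2⌋ : ℝ)) ^ 2))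
      =O[cofinite] fun j : ℤ => 1 / (j : ℝ) ^ 2
  eigen : ∀ j : ℤ, (ℓ : ℤ) ≤ |j| → IsNormalizedEigenfunction Avec a (lam j) (φ j)
  eigen_eq : ∀ j : ℤ, (ℓ : ℤ) ≤ |j| → ∀ θ : ℝ,
    φ j (pt θ) = ((1 / √(2 * Real.pi) : ℝ) : ℂ)
      * Complex.exp (-Complex.I * (((⌊avgA Avec + 1 / 2⌋ : ℝ) * θ
          + ∫ t in (0 : ℝ)..θ, angularComponent Avec t : ℝ) : ℂ))
      * (Complex.exp (Complex.I * (((avgA Avec + j) * θ : ℝ) : ℂ)) + R j θ)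
  remainder : ∃ C : ℝ, ∀ᶠ j : ℤ in cofinite, ∀ θ : ℝ, ‖R j θ‖ ≤ C / |(j : ℝ)|

/-- The Bessel function of the first kind `J_ν(t)`, for `t ≥ 0`. -/
def besselJ (ν t : ℝ) : ℝ :=
  (t / 2) ^ ν * ∑' k : ℕ,
    (-1 : ℝ) ^ k / (Real.Gamma (k + 1) * Real.Gamma (k + ν + 1)) * (t / 2) ^ (2 * k)

/-- `α(μ) = -√μ` (dimension two). -/
def alphaExp (μ : ℝ) : ℝ := -√μ

/-- `β(μ) = √μ` (dimension two). -/
def betaExp (μ : ℝ) : ℝ := √μ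

/-- The factor `i^{-β(μ)} j_{-α(μ)}(t)`; in dimension two `j_ν = J_ν`. The power of `i` is
the principal one, `e^{-iπβ/2}`. -/
def radialFactor (μ t : ℝ) : ℂ :=
  Complex.I ^ (-(betaExp μ : ℂ)) * (besselJ (-alphaExp μ) t : ℂ)

/-- The direction `x / |x|` of a nonzero vector (an arbitrary point for `x = 0`). -/
def direction (x : Plane) : UnitCircle :=
  if h : x = 0 then pt 0 else ⟨‖x‖⁻¹ • x, by simp [norm_smul, h]⟩

/-- The `k`-th term of the series defining the kernel `K(x, y)`. -/
def kernelTerm (μ : ℕ → ℝ) (ψ : ℕ → UnitCircle → ℂ) (x y : Plane) (k : ℕ) : ℂ :=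
  radialFactor (μ k) (‖x‖ * ‖y‖) * ψ k (direction x) * conj (ψ k (direction y))

/-- The kernel `K(x, y) = ∑_k i^{-β_k} j_{-α_k}(|x||y|) ψ_k(x/|x|) conj ψ_k(y/|y|)`. -/
def kernelK (μ : ℕ → ℝ) (ψ : ℕ → UnitCircle → ℂ) (x y : Plane) : ℂ :=
  ∑' k : ℕ, kernelTerm μ ψ x y k

/-- The `j`-th term of the series over the large eigenvalues, without the gauge factor:
`i^{-β(λ_j)} j_{-α(λ_j)}(r r') (e^{i(Ã+j)θ} + R_j(θ)) (e^{-i(Ã+j)θ'} + conj R_j(θ'))`. -/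
def highTerm (Avec : UnitCircle → Plane) (lam : ℤ → ℝ) (R : ℤ → ℝ → ℂ)
    (r r' θ θ' : ℝ) (j : ℤ) : ℂ :=
  radialFactor (lam j) (r * r')
    * (Complex.exp (Complex.I * (((avgA Avec + j) * θ : ℝ) : ℂ)) + R j θ)
    * (Complex.exp (-Complex.I * (((avgA Avec + j) * θ' : ℝ) : ℂ)) + conj (R j θ'))

end

/-!
A gauge transformation turns the magnetic operator into `(-i d/dθ + δ)² + a` with the constant field
`δ = Ã - ⌊Ã + 1/2⌋`, whose unperturbed eigenvalues `(j + δ)²` are simple with gaps of order `|j|`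
because `2δ` is not an integer. On the Fourier side the potential is a convolution operator, small
compared with these gaps, and a Lyapunov–Schmidt reduction around the frequency `j` produces one
eigenvalue near `ã + (j + δ)²` with an eigenvector `O(1/|j|)`-close to the `j`-th mode. The
second-order correction is `O(j⁻²)`: its terms at the frequencies `j + m` and `j - m` have equal
weights and almost opposite resolvent factors, and `|m| |â(m)|` is bounded. An eigenvector for
another high eigenvalue would be orthogonal to all these perturbed modes, which leaves no room for
it, so they exhaust the high spectrum. Finally `J_ν(t)` decays superexponentially in `ν`, and the
kernel formula is a reindexing of an absolutely convergent series.
-/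

noncomputable section

theorem fourier_zero_eq_one {T : ℝ} : (fourier 0 : C(AddCircle T, ℂ)) = 1 := by
  ext x
  exact fourier_zero

section CircleFourier

variable {T : ℝ} [hT : Fact (0 < T)]

open AddCircle MeasureTheory
open scoped NNReal

/-- The class in `L²(ℝ / Tℤ)` of a continuous function, for the Haar probability measure. -/
def circleL2 : C(AddCircle T, ℂ) →L[ℂ] Lp ℂ 2 (haarAddCircle (T := T)) :=
  ContinuousMap.toLp (E := ℂ) 2 haarAddCircle ℂ

/-- The `n`-th Fourier coefficient as a continuous linear functional on `C(ℝ / Tℤ)`. -/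
def circleCoeff (n : ℤ) : C(AddCircle T, ℂ) →L[ℂ] ℂ :=
  innerSL ℂ (fourierLp 2 n) ∘L circleL2

theorem circleCoeff_eq_repr (n : ℤ) (v : C(AddCircle T, ℂ)) :
    circleCoeff n v = fourierBasis.repr (circleL2 v) n := by
  rw [HilbertBasis.repr_apply_apply, coe_fourierBasis]
  simp [circleCoeff]

theorem circleCoeff_eq_fourierCoeff (n : ℤ) (v : C(AddCircle T, ℂ)) :
    circleCoeff n v = fourierCoeff v n := by
  rw [circleCoeff_eq_repr, fourierBasis_repr]
  exact fourierCoeff_toLp v n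

theorem circleCoeff_fourier (n m : ℤ) :
    circleCoeff n (fourier m : C(AddCircle T, ℂ)) = if n = m then 1 else 0 := by
  rw [circleCoeff_eq_fourierCoeff, fourierCoeff_fourier, Pi.single_apply]

theorem circleL2_injective :
    Function.Injective (circleL2 : C(AddCircle T, ℂ) → Lp ℂ 2 (haarAddCircle (T := T))) :=
  ContinuousMap.toLp_injective haarAddCircle

theorem circleL2_ne_zero {v : C(AddCircle T, ℂ)} (hv : v ≠ 0) : circleL2 v ≠ 0 :=
  (map_ne_zero_iff _ circleL2_injective).mpr hv

theorem eq_of_circleCoeff_eq {v w : C(AddCircle T, ℂ)}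
    (h : ∀ n, circleCoeff n v = circleCoeff n w) : v = w := by
  refine circleL2_injective (fourierBasis.repr.injective ?_)
  ext n
  rw [← circleCoeff_eq_repr, ← circleCoeff_eq_repr, h]

theorem hasSum_inner_circleCoeff (v w : C(AddCircle T, ℂ)) :
    HasSum (fun n => conj (circleCoeff n v) * circleCoeff n w)
      (inner ℂ (circleL2 v) (circleL2 w)) := by
  refine (fourierBasis.hasSum_inner_mul_inner (circleL2 v) (circleL2 w)).congr_fun fun n => ?_
  rw [circleCoeff_eq_repr, circleCoeff_eq_repr, HilbertBasis.repr_apply_apply,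
    HilbertBasis.repr_apply_apply, inner_conj_symm]

theorem hasSum_norm_sq_circleCoeff (v : C(AddCircle T, ℂ)) :
    HasSum (fun n => ‖circleCoeff n v‖ ^ 2) (‖circleL2 v‖ ^ 2) := by
  have h := hasSum_inner_circleCoeff v v
  rw [inner_self_eq_norm_sq_to_K] at h
  simp only [Complex.conj_mul'] at h
  exact Complex.hasSum_ofReal.mp (by simpa using h)

theorem inner_circleL2 (v w : C(AddCircle T, ℂ)) :
    inner ℂ (circleL2 v) (circleL2 w) = ∫ x, w x * conj (v x) ∂haarAddCircle :=
  ContinuousMap.inner_toLp haarAddCircle v w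

theorem inner_circleL2_mul (q v w : C(AddCircle T, ℂ)) :
    inner ℂ (circleL2 (q * v)) (circleL2 w) = inner ℂ (circleL2 v) (circleL2 (star q * w)) := by
  rw [inner_circleL2, inner_circleL2]
  congr 1 with x
  simp only [ContinuousMap.mul_apply, ContinuousMap.star_apply, map_mul, starRingEnd_apply]
  ring

theorem norm_sq_circleL2 (v : C(AddCircle T, ℂ)) :
    ‖circleL2 v‖ ^ 2 = ∫ x, ‖v x‖ ^ 2 ∂haarAddCircle := by
  have h := inner_circleL2 v v
  rw [inner_self_eq_norm_sq_to_K] at h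
  simp only [Complex.mul_conj'] at h
  refine Complex.ofReal_injective (.trans ?_ (h.trans ?_))
  · norm_cast
  · rw [← integral_complex_ofReal]
    norm_cast

theorem norm_circleL2_fourier (j : ℤ) : ‖circleL2 (fourier j : C(AddCircle T, ℂ))‖ = 1 :=
  orthonormal_fourier.1 j

theorem norm_circleL2_mul_le (q v : C(AddCircle T, ℂ)) :
    ‖circleL2 (q * v)‖ ≤ ‖q‖ * ‖circleL2 v‖ := by
  refine Lp.norm_le_mul_norm_of_ae_le_mul ?_
  filter_upwards [ContinuousMap.coeFn_toLp (p := 2) (𝕜 := ℂ) haarAddCircle (q * v),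
    ContinuousMap.coeFn_toLp (p := 2) (𝕜 := ℂ) haarAddCircle v] with x hqv hv
  rw [circleL2, hqv, hv, ContinuousMap.mul_apply, norm_mul]
  gcongr
  exact q.norm_coe_le_norm x

theorem norm_circleL2_le (v : C(AddCircle T, ℂ)) : ‖circleL2 v‖ ≤ ‖v‖ := by
  have h := norm_circleL2_mul_le v (fourier 0)
  rwa [norm_circleL2_fourier, fourier_zero_eq_one, mul_one, mul_one] at h

theorem norm_circleCoeff_le (v : C(AddCircle T, ℂ)) (n : ℤ) : ‖circleCoeff n v‖ ≤ ‖circleL2 v‖ := by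
  rw [circleCoeff_eq_repr, ← fourierBasis.repr.norm_map]
  exact lp.norm_apply_le_norm two_ne_zero _ n

theorem one_le_norm_circleL2_fourier_add {j : ℤ} {h : C(AddCircle T, ℂ)}
    (hj : circleCoeff j h = 0) :
    1 ≤ ‖circleL2 (fourier j + h)‖ := by
  have hle := norm_circleCoeff_le (fourier j + h) j
  rwa [map_add, hj, add_zero, circleCoeff_fourier, if_pos rfl, norm_one] at hle

theorem fourier_add_ne_zero {j : ℤ} {h : C(AddCircle T, ℂ)}
    (hj : circleCoeff j h = 0) :
    fourier j + h ≠ 0 := by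
  intro hzero
  have hle := one_le_norm_circleL2_fourier_add hj
  rw [hzero, map_zero, norm_zero] at hle
  linarith

theorem circleCoeff_mul_fourier (p : C(AddCircle T, ℂ)) (n j : ℤ) :
    circleCoeff n (p * fourier j) = circleCoeff (n - j) p := by
  simp only [circleCoeff_eq_fourierCoeff, fourierCoeff, smul_eq_mul, ContinuousMap.mul_apply]
  congr 1 with x
  rw [show -(n - j) = -n + j by ring, fourier_add]
  ring

theorem circleCoeff_star (p : C(AddCircle T, ℂ)) (n : ℤ) :
    circleCoeff n (star p) = conj (circleCoeff (-n) p) := by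
  simp only [circleCoeff_eq_fourierCoeff, fourierCoeff, ← integral_conj]
  congr 1 with x
  simp [-fourier_apply, fourier_neg]

/-- A Fourier multiplier with square-summable symbol. By Cauchy–Schwarz it maps `L²` into `C`. -/
def fourierMultiplier (c : lp (fun _ : ℤ => ℂ) 2) (u : C(AddCircle T, ℂ)) : C(AddCircle T, ℂ) :=
  ∑' n : ℤ, (c n * circleCoeff n u) • (fourier n : C(AddCircle T, ℂ))

theorem summable_and_tsum_norm_mul_circleCoeff_le (c : lp (fun _ : ℤ => ℂ) 2)
    (u : C(AddCircle T, ℂ)) :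
    Summable (fun n => ‖c n‖ * ‖circleCoeff n u‖) ∧
      ∑' n, ‖c n‖ * ‖circleCoeff n u‖ ≤ ‖c‖ * ‖circleL2 u‖ := by
  simp only [circleCoeff_eq_repr]
  rw [← fourierBasis.repr.norm_map (circleL2 u)]
  exact lp.tsum_mul_le_mul_norm (by simpa using Real.HolderConjugate.two_two) c _

theorem norm_fourierMultiplier_term (c : lp (fun _ : ℤ => ℂ) 2) (u : C(AddCircle T, ℂ)) (n : ℤ) :
    ‖(c n * circleCoeff n u) • (fourier n : C(AddCircle T, ℂ))‖ = ‖c n‖ * ‖circleCoeff n u‖ := by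
  rw [norm_smul, fourier_norm, mul_one, norm_mul]

theorem norm_fourierMultiplier_le (c : lp (fun _ : ℤ => ℂ) 2) (u : C(AddCircle T, ℂ)) :
    ‖fourierMultiplier c u‖ ≤ ‖c‖ * ‖u‖ := by
  obtain ⟨hs, hle⟩ := summable_and_tsum_norm_mul_circleCoeff_le c u
  calc ‖fourierMultiplier c u‖ ≤ ∑' n, ‖c n‖ * ‖circleCoeff n u‖ :=
        tsum_of_norm_bounded hs.hasSum fun n => (norm_fourierMultiplier_term c u n).le
    _ ≤ ‖c‖ * ‖circleL2 u‖ := hle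
    _ ≤ ‖c‖ * ‖u‖ := by gcongr; exact norm_circleL2_le u

theorem circleCoeff_fourierMultiplier (c : lp (fun _ : ℤ => ℂ) 2) (u : C(AddCircle T, ℂ)) (n : ℤ) :
    circleCoeff n (fourierMultiplier c u) = c n * circleCoeff n u := by
  have hs : Summable fun m => (c m * circleCoeff m u) • (fourier m : C(AddCircle T, ℂ)) :=
    .of_norm <| (summable_and_tsum_norm_mul_circleCoeff_le c u).1.congr fun m =>
      (norm_fourierMultiplier_term c u m).symm
  rw [fourierMultiplier, (circleCoeff n).map_tsum hs, tsum_eq_single n]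
  · rw [map_smul, circleCoeff_fourier, if_pos rfl, smul_eq_mul, mul_one]
  · intro m hm
    rw [map_smul, circleCoeff_fourier, if_neg hm.symm, smul_zero]

/-- `fourierMultiplier` as a bounded operator on `C(ℝ / Tℤ)`. -/
def fourierMultiplierCLM (c : lp (fun _ : ℤ => ℂ) 2) :
    C(AddCircle T, ℂ) →L[ℂ] C(AddCircle T, ℂ) :=
  LinearMap.mkContinuous
    { toFun := fourierMultiplier c
      map_add' := fun u w => eq_of_circleCoeff_eq fun n => by
        simp only [map_add, circleCoeff_fourierMultiplier, mul_add]
      map_smul' := fun z u => eq_of_circleCoeff_eq fun n => by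
        simp only [map_smul, circleCoeff_fourierMultiplier, smul_eq_mul, RingHom.id_apply]
        ring }
    ‖c‖ (norm_fourierMultiplier_le c)

theorem norm_fourierMultiplierCLM_le (c : lp (fun _ : ℤ => ℂ) 2) :
    ‖(fourierMultiplierCLM c : C(AddCircle T, ℂ) →L[ℂ] C(AddCircle T, ℂ))‖ ≤ ‖c‖ :=
  LinearMap.mkContinuous_norm_le _ (norm_nonneg c) _

theorem circleCoeff_fourierMultiplierCLM (c : lp (fun _ : ℤ => ℂ) 2) (u : C(AddCircle T, ℂ))
    (n : ℤ) : circleCoeff n (fourierMultiplierCLM c u) = c n * circleCoeff n u :=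
  circleCoeff_fourierMultiplier c u n

theorem two_smul_fourierCoeff {E : Type*} [NormedAddCommGroup E] [NormedSpace ℂ E]
    {f : AddCircle T → E} (hf : Continuous f) {n : ℤ} (hn : n ≠ 0) :
    (2 : ℂ) • fourierCoeff f n =
      ∫ x, fourier (-n) x • (f x - f (x - (T / 2 / (-n : ℤ) : ℝ))) ∂haarAddCircle := by
  set s : AddCircle T := ((T / 2 / (-n : ℤ) : ℝ) : AddCircle T)
  have hsign (x : AddCircle T) : fourier (-n) (x - s) = -fourier (-n) x := by
    have h := fourier_add_half_inv_index (neg_ne_zero.mpr hn) hT.out (x - s)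
    rw [sub_add_cancel] at h
    rw [h, neg_neg]
  have hint {g : AddCircle T → E} (hg : Continuous g) : Integrable g haarAddCircle :=
    hg.integrable_of_hasCompactSupport (.of_compactSpace g)
  have htranslate : fourierCoeff f n = ∫ x, fourier (-n) (x - s) • f (x - s) ∂haarAddCircle :=
    (integral_sub_right_eq_self (fun x => fourier (-n) x • f x) s).symm
  rw [two_smul]
  nth_rw 2 [htranslate]
  rw [fourierCoeff, ← integral_add (hint (by fun_prop)) (hint (by fun_prop))]
  congr 1 with x
  rw [hsign, neg_smul, ← sub_eq_add_neg, ← smul_sub]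

theorem abs_mul_norm_fourierCoeff_le_of_lipschitzWith {E : Type*} [NormedAddCommGroup E]
    [NormedSpace ℂ E] {f : AddCircle T → E} {L : ℝ≥0} (hf : LipschitzWith L fun t : ℝ => f t)
    (n : ℤ) : |(n : ℝ)| * ‖fourierCoeff f n‖ ≤ L * T / 4 := by
  have hT0 := hT.out
  rcases eq_or_ne n 0 with rfl | hn
  · simp only [Int.cast_zero, abs_zero, zero_mul]
    positivity
  have hn0 : |(n : ℝ)| ≠ 0 := abs_ne_zero.mpr (Int.cast_ne_zero.mpr hn)
  have hcont : Continuous f := continuous_coinduced_dom.mpr hf.continuous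
  have hbound (x : AddCircle T) :
      ‖fourier (-n) x • (f x - f (x - (T / 2 / (-n : ℤ) : ℝ)))‖ ≤ L * (T / 2 / |(n : ℝ)|) := by
    induction x using QuotientAddGroup.induction_on with
    | H t =>
      rw [norm_smul, fourier_apply, Circle.norm_coe, one_mul]
      refine (hf.dist_le_mul t (t - T / 2 / (-n : ℤ)) |> (dist_eq_norm _ _).ge.trans).trans_eq ?_
      rw [Real.dist_eq, sub_sub_cancel, abs_div, abs_of_pos (half_pos hT0), Int.cast_neg, abs_neg]
  have hnorm : 2 * ‖fourierCoeff f n‖ ≤ L * (T / 2 / |(n : ℝ)|) := by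
    rw [← Complex.norm_two, ← norm_smul, two_smul_fourierCoeff hcont hn]
    exact (norm_integral_le_of_norm_le_const (.of_forall hbound)).trans_eq (by simp)
  calc |(n : ℝ)| * ‖fourierCoeff f n‖ = |(n : ℝ)| * (2 * ‖fourierCoeff f n‖) / 2 := by ring
    _ ≤ |(n : ℝ)| * (L * (T / 2 / |(n : ℝ)|)) / 2 := by gcongr
    _ = L * T / 4 := by field_simp; ring

end CircleFourier

section LyapunovSchmidt

variable {𝕜 E : Type*} [RCLike 𝕜] [NormedAddCommGroup E] [NormedSpace 𝕜 E]

/-- The map whose fixed points are the complementary components `h` of the eigenvectors `u + h` of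
a perturbation by `B`: here `G` is the reduced resolvent at the unperturbed eigenvector `u`, and `ℓ`
is the coordinate along `u`, so that `ℓ (B h)` is the correction to the eigenvalue (`ℓ (B u) = 0` is
the normalization of `B`). -/
def lyapunovSchmidtMap (G B : E →L[𝕜] E) (ℓ : E →L[𝕜] 𝕜) (u h : E) : E :=
  G (B u + B h - ℓ (B h) • h)

variable {G B : E →L[𝕜] E} {ℓ : E →L[𝕜] 𝕜} {u : E}

theorem norm_lyapunovSchmidtMap_le (hℓ : ‖ℓ‖ ≤ 1) (hu : ‖u‖ ≤ 1) {h : E} (hh : ‖h‖ ≤ 1) :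
    ‖lyapunovSchmidtMap G B ℓ u h‖ ≤ 3 * ‖G‖ * ‖B‖ := by
  have hBu : ‖B u‖ ≤ ‖B‖ := B.unit_le_opNorm u hu
  have hBh : ‖B h‖ ≤ ‖B‖ := B.unit_le_opNorm h hh
  have hcorr : ‖ℓ (B h) • h‖ ≤ ‖B‖ := by
    rw [norm_smul]
    refine (mul_le_of_le_one_right (norm_nonneg _) hh).trans ?_
    exact (by simpa using ℓ.le_of_opNorm_le hℓ (B h) : ‖ℓ (B h)‖ ≤ ‖B h‖).trans hBh
  calc ‖lyapunovSchmidtMap G B ℓ u h‖ ≤ ‖G‖ * ‖B u + B h - ℓ (B h) • h‖ := G.le_opNorm _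
    _ ≤ ‖G‖ * (‖B u‖ + ‖B h‖ + ‖ℓ (B h) • h‖) := by
      gcongr; exact (norm_sub_le _ _).trans (by gcongr; exact norm_add_le _ _)
    _ ≤ ‖G‖ * (‖B‖ + ‖B‖ + ‖B‖) := by gcongr
    _ = 3 * ‖G‖ * ‖B‖ := by ring

theorem norm_lyapunovSchmidtMap_sub_le (hℓ : ‖ℓ‖ ≤ 1) {h k : E} (hh : ‖h‖ ≤ 1) (hk : ‖k‖ ≤ 1) :
    ‖lyapunovSchmidtMap G B ℓ u h - lyapunovSchmidtMap G B ℓ u k‖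
      ≤ 3 * ‖G‖ * ‖B‖ * ‖h - k‖ := by
  have hℓB (w : E) : ‖ℓ (B w)‖ ≤ ‖B‖ * ‖w‖ := by
    exact (by simpa using ℓ.le_of_opNorm_le hℓ (B w) : ‖ℓ (B w)‖ ≤ ‖B w‖).trans (B.le_opNorm w)
  have hsplit : lyapunovSchmidtMap G B ℓ u h - lyapunovSchmidtMap G B ℓ u k
      = G (B (h - k) - (ℓ (B (h - k)) • h + ℓ (B k) • (h - k))) := by
    simp only [lyapunovSchmidtMap, ← map_sub]
    congr 1
    simp only [map_sub, sub_smul, smul_sub]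
    abel
  have hleft : ‖ℓ (B (h - k)) • h‖ ≤ ‖B‖ * ‖h - k‖ := by
    rw [norm_smul]
    exact (mul_le_of_le_one_right (norm_nonneg _) hh).trans (hℓB _)
  have hright : ‖ℓ (B k) • (h - k)‖ ≤ ‖B‖ * ‖h - k‖ := by
    rw [norm_smul]
    gcongr
    exact (hℓB k).trans (mul_le_of_le_one_right (norm_nonneg _) hk)
  rw [hsplit]
  calc _ ≤ ‖G‖ * (‖B (h - k)‖ + (‖ℓ (B (h - k)) • h‖ + ‖ℓ (B k) • (h - k)‖)) :=
        (G.le_opNorm _).trans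
          (by gcongr; exact (norm_sub_le _ _).trans (by gcongr; exact norm_add_le _ _))
    _ ≤ ‖G‖ * (‖B‖ * ‖h - k‖ + (‖B‖ * ‖h - k‖ + ‖B‖ * ‖h - k‖)) := by
      gcongr; exact B.le_opNorm _
    _ = 3 * ‖G‖ * ‖B‖ * ‖h - k‖ := by ring

theorem exists_lyapunovSchmidtMap_eq_self [CompleteSpace E] (hℓ : ‖ℓ‖ ≤ 1) (hu : ‖u‖ ≤ 1)
    (hGB : 6 * ‖G‖ * ‖B‖ ≤ 1) :
    ∃ h, ‖h‖ ≤ 3 * ‖G‖ * ‖B‖ ∧ lyapunovSchmidtMap G B ℓ u h = h := by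
  have hmaps : Set.MapsTo (lyapunovSchmidtMap G B ℓ u) (Metric.closedBall 0 1)
      (Metric.closedBall 0 1) := fun h hh => by
    rw [mem_closedBall_zero_iff] at hh ⊢
    linarith [norm_lyapunovSchmidtMap_le (G := G) (B := B) hℓ hu hh]
  have hcontr : ContractingWith (1 / 2) (hmaps.restrict _ _ _) := by
    refine ⟨by norm_num, LipschitzWith.of_dist_le_mul ?_⟩
    rintro ⟨h, hh⟩ ⟨k, hk⟩
    rw [mem_closedBall_zero_iff] at hh hk
    rw [Subtype.dist_eq, Subtype.dist_eq, dist_eq_norm, dist_eq_norm]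
    refine (norm_lyapunovSchmidtMap_sub_le hℓ hh hk).trans ?_
    gcongr
    push_cast
    linarith
  obtain ⟨h, hh, hfix, -⟩ := ContractingWith.exists_fixedPoint'
    Metric.isClosed_closedBall.isComplete hmaps hcontr
    (Metric.mem_closedBall_self zero_le_one) (edist_ne_top _ _)
  rw [mem_closedBall_zero_iff] at hh
  exact ⟨h, hfix.eq ▸ norm_lyapunovSchmidtMap_le hℓ hu hh, hfix⟩

end LyapunovSchmidt

/-- The symbol `1 / ((j + δ)² - (n + δ)²)` of the reduced resolvent of `(-i d/dθ + δ)²` at the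
eigenvalue `(j + δ)²`. Its value at `n = j` is zero, as `0⁻¹ = 0`. -/
def resolventCoeff (δ : ℝ) (j n : ℤ) : ℝ := (((j : ℝ) + δ) ^ 2 - ((n : ℝ) + δ) ^ 2)⁻¹

theorem resolventCoeff_self (δ : ℝ) (j : ℤ) : resolventCoeff δ j j = 0 := by
  rw [resolventCoeff, sub_self, inv_zero]

theorem sq_add_sub_sq_add (δ : ℝ) (j n : ℤ) :
    ((j : ℝ) + δ) ^ 2 - ((n : ℝ) + δ) ^ 2 = ((j : ℝ) - n) * ((n : ℝ) + j + 2 * δ) := by ring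

theorem one_le_abs_cast_sub {j n : ℤ} (hn : n ≠ j) : 1 ≤ |(j : ℝ) - n| := by
  exact_mod_cast Int.one_le_abs (sub_ne_zero.mpr hn.symm)

theorem summable_inv_sq_int_add (a : ℝ) : Summable fun n : ℤ => (((n : ℝ) + a) ^ 2)⁻¹ :=
  ((Real.summable_one_div_int_add_rpow a 2).mpr one_lt_two).congr fun n => by
    rw [one_div, Real.rpow_two, sq_abs]

theorem sq_resolventCoeff_le_inv (δ : ℝ) (j n : ℤ) :
    resolventCoeff δ j n ^ 2 ≤ (((n : ℝ) + (j + 2 * δ)) ^ 2)⁻¹ := by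
  rcases eq_or_ne n j with rfl | hn
  · rw [resolventCoeff_self, zero_pow two_ne_zero]
    positivity
  · rw [resolventCoeff, sq_add_sub_sq_add, inv_pow, mul_pow, mul_inv, ← add_assoc]
    refine mul_le_of_le_one_left (by positivity) (inv_le_one_of_one_le₀ ?_)
    exact (one_le_sq_iff_one_le_abs _).mpr (one_le_abs_cast_sub hn)

theorem summable_sq_resolventCoeff (δ : ℝ) (j : ℤ) : Summable fun n => resolventCoeff δ j n ^ 2 :=
  .of_nonneg_of_le (fun _ => sq_nonneg _) (sq_resolventCoeff_le_inv δ j)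
    (summable_inv_sq_int_add _)

/-- `resolventCoeff δ j` as a square-summable symbol. -/
def resolventSymbol (δ : ℝ) (j : ℤ) : lp (fun _ : ℤ => ℂ) 2 :=
  ⟨fun n => (resolventCoeff δ j n : ℂ), memℓp_gen <| by
    simpa using summable_sq_resolventCoeff δ j⟩

theorem resolventSymbol_apply (δ : ℝ) (j n : ℤ) :
    resolventSymbol δ j n = (resolventCoeff δ j n : ℂ) := rfl

theorem tsum_sq_resolventCoeff (δ : ℝ) (j : ℤ) :
    ∑' n, resolventCoeff δ j n ^ 2 = ‖resolventSymbol δ j‖ ^ 2 := by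
  have h := lp.norm_rpow_eq_tsum (by norm_num) (resolventSymbol δ j)
  simpa [resolventSymbol_apply] using h.symm

/-- `δ` lies in the reduced interval `[-1/2, 1/2]`, and `2δ` keeps distance at least `κ > 0` from
the integers, which separates the numbers `(n + δ)²`, `n ∈ ℤ`. -/
structure IsNonresonant (δ κ : ℝ) : Prop where
  pos : 0 < κ
  abs_le : |δ| ≤ 1 / 2
  le_abs : ∀ m : ℤ, κ ≤ |2 * δ + m|

theorem exists_isNonresonant {δ : ℝ} (hδ : |δ| ≤ 1 / 2) (hres : ∀ m : ℤ, 2 * δ ≠ m) :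
    ∃ κ, IsNonresonant δ κ := by
  refine ⟨|2 * δ - round (2 * δ)|, abs_pos.mpr (sub_ne_zero.mpr (hres _)), hδ, fun m => ?_⟩
  simpa using round_le (2 * δ) (-m)

namespace IsNonresonant

variable {δ κ : ℝ} (hδ : IsNonresonant δ κ)
include hδ

theorem two_mul_ne (n : ℤ) : 2 * δ ≠ n := by
  intro h
  have hle := hδ.le_abs (-n)
  rw [h, Int.cast_neg, add_neg_cancel, abs_zero] at hle
  exact hδ.pos.not_ge hle

theorem le_abs_add (j n : ℤ) : κ ≤ |(n : ℝ) + j + 2 * δ| := by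
  simpa [add_comm, add_left_comm] using hδ.le_abs (n + j)

theorem abs_le_add {j : ℤ} (hj : j ≠ 0) (n : ℤ) :
    |(j : ℝ)| ≤ |(j : ℝ) - n| + |(n : ℝ) + j + 2 * δ| := by
  have hj1 : (1 : ℝ) ≤ |(j : ℝ)| := by exact_mod_cast Int.one_le_abs hj
  calc |(j : ℝ)| ≤ 2 * |(j : ℝ)| - 2 * |δ| := by linarith [hδ.abs_le]
    _ = |2 * (j : ℝ)| - |-(2 * δ)| := by rw [abs_neg, abs_mul, abs_mul, abs_two]
    _ ≤ |2 * (j : ℝ) - -(2 * δ)| := abs_sub_abs_le_abs_sub _ _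
    _ = |((j : ℝ) - n) + ((n : ℝ) + j + 2 * δ)| := by ring_nf
    _ ≤ _ := abs_add_le _ _

theorem le_one_sub : κ ≤ 1 - 2 * |δ| := by
  have hpos := hδ.le_abs 1
  have hneg := hδ.le_abs (-1)
  have habs := _root_.abs_le.mp hδ.abs_le
  push_cast at hpos hneg
  rw [abs_of_nonneg (by linarith)] at hpos
  rw [abs_of_nonpos (by linarith)] at hneg
  rcases abs_cases δ with h | h <;> linarith

theorem gap {j n : ℤ} (hj : j ≠ 0) (hn : n ≠ j) :
    κ / 2 * |(j : ℝ)| ≤ |((j : ℝ) + δ) ^ 2 - ((n : ℝ) + δ) ^ 2| := by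
  rw [sq_add_sub_sq_add, abs_mul]
  have hdiff := one_le_abs_cast_sub hn
  have hsum := hδ.le_abs_add j n
  have hle := hδ.abs_le_add hj n
  have hκ := hδ.pos
  have hκ1 : κ ≤ 1 := by linarith [hδ.le_one_sub, abs_nonneg δ]
  rcases le_total (|(j : ℝ)| / 2) |(j : ℝ) - n| with hlarge | hsmall
  · nlinarith [abs_nonneg (j : ℝ), hlarge]
  · have : |(j : ℝ)| / 2 ≤ |(n : ℝ) + j + 2 * δ| := by linarith
    nlinarith [abs_nonneg (j : ℝ)]

theorem gap_pos {j n : ℤ} (hj : j ≠ 0) (hn : n ≠ j) :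
    0 < |((j : ℝ) + δ) ^ 2 - ((n : ℝ) + δ) ^ 2| :=
  have := hδ.pos
  have : 0 < |(j : ℝ)| := abs_pos.mpr (Int.cast_ne_zero.mpr hj)
  (by positivity : 0 < κ / 2 * |(j : ℝ)|).trans_le (hδ.gap hj hn)

theorem abs_mul_abs_resolventCoeff_le {j : ℤ} (hj : j ≠ 0) (n : ℤ) :
    |(j : ℝ)| * |resolventCoeff δ j n| ≤ |(n : ℝ) - j|⁻¹ + |(n : ℝ) + j + 2 * δ|⁻¹ := by
  rcases eq_or_ne n j with rfl | hn
  · rw [resolventCoeff_self, abs_zero, mul_zero]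
    positivity
  have hdiff : 0 < |(j : ℝ) - n| := one_pos.trans_le (one_le_abs_cast_sub hn)
  have hsum : 0 < |(n : ℝ) + j + 2 * δ| := hδ.pos.trans_le (hδ.le_abs_add j n)
  rw [resolventCoeff, sq_add_sub_sq_add, abs_inv, abs_mul, abs_sub_comm (n : ℝ) j,
    inv_add_inv hdiff.ne' hsum.ne', ← div_eq_mul_inv]
  gcongr
  exact hδ.abs_le_add hj n

theorem sq_resolventCoeff_le {j : ℤ} (hj : j ≠ 0) (n : ℤ) :
    resolventCoeff δ j n ^ 2
      ≤ 2 / |(j : ℝ)| ^ 2 * ((((n - j : ℤ) : ℝ) ^ 2)⁻¹ + ((((n + j : ℤ) : ℝ) + 2 * δ) ^ 2)⁻¹) := by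
  have hj0 : 0 < |(j : ℝ)| := abs_pos.mpr (Int.cast_ne_zero.mpr hj)
  have h := pow_le_pow_left₀ (by positivity) (hδ.abs_mul_abs_resolventCoeff_le hj n) 2
  rw [mul_pow, sq_abs (resolventCoeff δ j n)] at h
  rw [div_mul_eq_mul_div, le_div_iff₀ (pow_pos hj0 2), mul_comm]
  refine h.trans (add_sq_le.trans_eq ?_)
  rw [inv_pow, inv_pow, sq_abs, sq_abs, Int.cast_sub, Int.cast_add]

theorem exists_norm_resolventSymbol_le :
    ∃ C : ℝ, ∀ j : ℤ, j ≠ 0 → ‖resolventSymbol δ j‖ ≤ C / |(j : ℝ)| := by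
  have hs0 : Summable fun n : ℤ => ((n : ℝ) ^ 2)⁻¹ := by simpa using summable_inv_sq_int_add 0
  have hsδ := summable_inv_sq_int_add (2 * δ)
  set S := ∑' n : ℤ, ((n : ℝ) ^ 2)⁻¹ + ∑' n : ℤ, (((n : ℝ) + 2 * δ) ^ 2)⁻¹
  have hS : 0 ≤ S := add_nonneg (tsum_nonneg fun n => by positivity)
    (tsum_nonneg fun n => by positivity)
  refine ⟨√(2 * S), fun j hj => ?_⟩
  have hmaj := (((Equiv.subRight j).hasSum_iff.mpr hs0.hasSum).add
    ((Equiv.addRight j).hasSum_iff.mpr hsδ.hasSum)).mul_left (2 / |(j : ℝ)| ^ 2)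
  refine le_of_sq_le_sq ?_ (by positivity)
  calc ‖resolventSymbol δ j‖ ^ 2 = ∑' n, resolventCoeff δ j n ^ 2 :=
        (tsum_sq_resolventCoeff δ j).symm
    _ ≤ 2 / |(j : ℝ)| ^ 2 * S :=
        hasSum_le (hδ.sq_resolventCoeff_le hj) (summable_sq_resolventCoeff δ j).hasSum hmaj
    _ = 2 * S / |(j : ℝ)| ^ 2 := div_mul_eq_mul_div _ _ _
    _ = (√(2 * S) / |(j : ℝ)|) ^ 2 := by rw [div_pow, Real.sq_sqrt (mul_nonneg zero_le_two hS)]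

/-- At the frequencies `j + m` and `j - m` the leading parts of the resolvent cancel. -/
theorem abs_resolventCoeff_add_le {j : ℤ} (hj : j ≠ 0) (m : ℤ) :
    |resolventCoeff δ j (j + m) + resolventCoeff δ j (j - m)|
      ≤ (m : ℝ) ^ 2 * (resolventCoeff δ j (j + m) ^ 2 + resolventCoeff δ j (j - m) ^ 2) := by
  rcases eq_or_ne m 0 with rfl | hm
  · simp [resolventCoeff_self]
  set r := resolventCoeff δ j (j + m) with hr
  set s := resolventCoeff δ j (j - m) with hs
  have hr0 := abs_pos.mp (hδ.gap_pos hj (n := j + m) (by simpa using hm))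
  have hs0 := abs_pos.mp (hδ.gap_pos hj (n := j - m) (by simpa using hm))
  have hcancel : r + s = -(m : ℝ) ^ 2 * (2 * (r * s)) := by
    rw [hr, hs, resolventCoeff, resolventCoeff, inv_add_inv hr0 hs0, ← mul_inv, div_eq_mul_inv]
    push_cast
    ring
  have hamgm : |2 * (r * s)| ≤ r ^ 2 + s ^ 2 := by
    rw [← mul_assoc]
    exact _root_.abs_le.mpr ⟨by linarith [sq_nonneg (r + s)], two_mul_le_add_sq r s⟩
  rw [hcancel, abs_mul, abs_neg, abs_of_nonneg (sq_nonneg (m : ℝ))]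
  gcongr

end IsNonresonant

theorem card_mul_le_card_of_orthonormal {𝕜 H ι κ : Type*} [RCLike 𝕜] [NormedAddCommGroup H]
    [InnerProductSpace 𝕜 H] {v : ι → H} (hv : Orthonormal 𝕜 v) {e : κ → H} (he : ∀ n, ‖e n‖ ≤ 1)
    (s : Finset ι) (F : Finset κ) {c : ℝ} (hc : ∀ i ∈ s, c ≤ ∑ n ∈ F, ‖inner 𝕜 (v i) (e n)‖ ^ 2) :
    s.card * c ≤ F.card :=
  calc s.card * c = ∑ _i ∈ s, c := by rw [Finset.sum_const, nsmul_eq_mul]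
    _ ≤ ∑ i ∈ s, ∑ n ∈ F, ‖inner 𝕜 (v i) (e n)‖ ^ 2 := Finset.sum_le_sum hc
    _ = ∑ n ∈ F, ∑ i ∈ s, ‖inner 𝕜 (v i) (e n)‖ ^ 2 := Finset.sum_comm
    _ ≤ ∑ _n ∈ F, (1 : ℝ) := Finset.sum_le_sum fun n _ =>
        (hv.sum_inner_products_le _).trans (pow_le_one₀ (norm_nonneg _) (he n))
    _ = F.card := by rw [Finset.sum_const, nsmul_eq_mul, mul_one]

theorem tendsto_sq_int_add_cofinite (δ : ℝ) :
    Tendsto (fun n : ℤ => ((n : ℝ) + δ) ^ 2) cofinite atTop := by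
  have h := (tendsto_pow_atTop two_ne_zero).comp <| (tendsto_norm_cocompact_atTop (E := ℝ)).comp <|
    (Homeomorph.addRight δ).isClosedEmbedding.tendsto_cocompact.comp Int.tendsto_coe_cofinite
  exact h.congr fun n => sq_abs _

instance fact_two_pi_pos : Fact (0 < 2 * Real.pi) := ⟨Real.two_pi_pos⟩

/-- The circle `ℝ / 2πℤ`, on which the angular variable lives. -/
abbrev Circ : Type := AddCircle (2 * Real.pi)

/-- The eigenvalue equation `(-i d/dθ + δ)² v + q v = z v` on the circle, written in Fourier
coefficients. -/
def IsFourierEigen (δ : ℝ) (q : C(Circ, ℂ)) (z : ℂ) (v : C(Circ, ℂ)) : Prop :=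
  ∀ n : ℤ, (z - ((n + δ) ^ 2 : ℝ)) * circleCoeff n v = circleCoeff n (q * v)

namespace IsFourierEigen

variable {δ : ℝ} {q v w : C(Circ, ℂ)} {z z' : ℂ}

theorem smul (hv : IsFourierEigen δ q z v) (c : ℂ) : IsFourierEigen δ q z (c • v) := fun n => by
  rw [mul_smul_comm, map_smul, map_smul, smul_eq_mul, smul_eq_mul, mul_left_comm, hv n]

theorem add_const (hv : IsFourierEigen δ q z v) (c : ℂ) :
    IsFourierEigen δ (q + c • 1) (z + c) v := fun n => by
  rw [add_mul, smul_mul_assoc, one_mul, map_add, map_smul, smul_eq_mul, ← hv n]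
  ring

theorem le_sum_norm_sq_circleCoeff (hv : IsFourierEigen δ q z v) {F : Finset ℤ} {D : ℝ} (hD : 0 < D)
    (hF : ∀ n ∉ F, D ≤ ‖z - ((n + δ) ^ 2 : ℝ)‖) :
    (1 - (‖q‖ / D) ^ 2) * ‖circleL2 v‖ ^ 2 ≤ ∑ n ∈ F, ‖circleCoeff n v‖ ^ 2 := by
  have hterm (n : ℤ) : ‖circleCoeff n v‖ ^ 2
      ≤ (if n ∈ F then ‖circleCoeff n v‖ ^ 2 else 0) + D⁻¹ ^ 2 * ‖circleCoeff n (q * v)‖ ^ 2 := by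
    split_ifs with hn
    · exact le_add_of_nonneg_right (by positivity)
    · rw [zero_add, ← mul_pow, ← hv n, norm_mul, ← mul_assoc]
      refine pow_le_pow_left₀ (norm_nonneg _) (le_mul_of_one_le_left (norm_nonneg _) ?_) 2
      rw [inv_mul_eq_div, one_le_div hD]
      exact hF n hn
  have hsum := hasSum_le hterm (hasSum_norm_sq_circleCoeff v)
    ((hasSum_sum_of_ne_finset_zero fun n hn => if_neg hn).add
      ((hasSum_norm_sq_circleCoeff (q * v)).mul_left (D⁻¹ ^ 2)))
  rw [Finset.sum_congr rfl fun n hn => if_pos hn] at hsum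
  have hqv : D⁻¹ ^ 2 * ‖circleL2 (q * v)‖ ^ 2 ≤ (‖q‖ / D) ^ 2 * ‖circleL2 v‖ ^ 2 := by
    rw [← mul_pow, ← mul_pow, inv_mul_eq_div, div_mul_eq_mul_div]
    gcongr
    exact norm_circleL2_mul_le q v
  linarith

theorem three_quarters_mul_le_sum_norm_sq_circleCoeff (hv : IsFourierEigen δ q z v)
    {F : Finset ℤ} {D : ℝ} (hD : 0 < D) (hqD : 2 * ‖q‖ ≤ D)
    (hF : ∀ n ∉ F, D ≤ ‖z - ((n + δ) ^ 2 : ℝ)‖) :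
    3 / 4 * ‖circleL2 v‖ ^ 2 ≤ ∑ n ∈ F, ‖circleCoeff n v‖ ^ 2 := by
  have hratio : (‖q‖ / D) ^ 2 ≤ (1 / 2) ^ 2 :=
    pow_le_pow_left₀ (by positivity) ((div_le_div_iff₀ hD two_pos).mpr (by linarith)) 2
  exact (by gcongr; linarith : _ ≤ _).trans (hv.le_sum_norm_sq_circleCoeff hD hF)

theorem exists_norm_sub_lt (hv : IsFourierEigen δ q z v) (h0 : v ≠ 0) {D : ℝ} (hD : ‖q‖ < D) :
    ∃ n : ℤ, ‖z - ((n + δ) ^ 2 : ℝ)‖ < D := by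
  by_contra! hfar
  have hDpos : 0 < D := (norm_nonneg q).trans_lt hD
  have hmass := hv.le_sum_norm_sq_circleCoeff (F := ∅) hDpos fun n _ => hfar n
  have hratio : (‖q‖ / D) ^ 2 < 1 :=
    pow_lt_one₀ (by positivity) ((div_lt_one hDpos).mpr hD) two_ne_zero
  have hvpos : 0 < ‖circleL2 v‖ ^ 2 := pow_pos (norm_pos_iff.mpr (circleL2_ne_zero h0)) 2
  rw [Finset.sum_empty] at hmass
  exact hmass.not_gt (mul_pos (sub_pos.mpr hratio) hvpos)

theorem conj_sub_mul_inner_eq_zero (hq : star q = q) (hv : IsFourierEigen δ q z v)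
    (hw : IsFourierEigen δ q z' w) :
    (conj z - z') * inner ℂ (circleL2 v) (circleL2 w) = 0 := by
  have hadj := inner_circleL2_mul q v w
  rw [hq] at hadj
  have hterm (n : ℤ) : (conj z - z') * (conj (circleCoeff n v) * circleCoeff n w)
      = conj (circleCoeff n (q * v)) * circleCoeff n w
        - conj (circleCoeff n v) * circleCoeff n (q * w) := by
    rw [← hv n, ← hw n, map_mul, map_sub, Complex.conj_ofReal]
    ring
  have hdiff := (hasSum_inner_circleCoeff (q * v) w).sub (hasSum_inner_circleCoeff v (q * w))
  rw [hadj, sub_self] at hdiff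
  exact ((hasSum_inner_circleCoeff v w).mul_left _).unique (hdiff.congr_fun hterm)

theorem conj_eq (hq : star q = q) (hv : IsFourierEigen δ q z v) (h0 : v ≠ 0) : conj z = z :=
  sub_eq_zero.mp <| (mul_eq_zero_iff_right (inner_self_ne_zero.mpr (circleL2_ne_zero h0))).mp <|
    hv.conj_sub_mul_inner_eq_zero hq hv

theorem inner_eq_zero (hq : star q = q) {s t : ℝ} (hst : s ≠ t) (hv : IsFourierEigen δ q s v)
    (hw : IsFourierEigen δ q t w) : inner ℂ (circleL2 v) (circleL2 w) = 0 := by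
  refine (mul_eq_zero_iff_left ?_).mp (hv.conj_sub_mul_inner_eq_zero hq hw)
  rw [Complex.conj_ofReal, ← Complex.ofReal_sub]
  exact Complex.ofReal_ne_zero.mpr (sub_ne_zero.mpr hst)

theorem three_quarters_mul_le_norm_sq_circleCoeff {κ W : ℝ} (hδ : IsNonresonant δ κ) {j : ℤ}
    (hj : j ≠ 0) (hv : IsFourierEigen δ q z v) (hz : ‖z - ((j + δ) ^ 2 : ℝ)‖ ≤ W)
    (hW : W + 2 * ‖q‖ < κ / 2 * |(j : ℝ)|) :
    3 / 4 * ‖circleL2 v‖ ^ 2 ≤ ‖circleCoeff j v‖ ^ 2 := by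
  set D := κ / 2 * |(j : ℝ)| - W with hD_def
  have hqD : 2 * ‖q‖ < D := lt_sub_iff_add_lt'.mpr hW
  have hD : 0 < D := (by positivity : 0 ≤ 2 * ‖q‖).trans_lt hqD
  have hfar (n : ℤ) (hn : n ∉ ({j} : Finset ℤ)) : D ≤ ‖z - ((n + δ) ^ 2 : ℝ)‖ := by
    have hgap := hδ.gap hj (Finset.notMem_singleton.mp hn)
    have htri := norm_sub_norm_le (((j + δ) ^ 2 : ℝ) - ((n + δ) ^ 2 : ℝ) : ℂ)
      (((j + δ) ^ 2 : ℝ) - z)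
    rw [sub_sub_sub_cancel_left, norm_sub_rev _ z, ← Complex.ofReal_sub, Complex.norm_real,
      Real.norm_eq_abs] at htri
    linarith
  simpa only [Finset.sum_singleton] using
    hv.three_quarters_mul_le_sum_norm_sq_circleCoeff hD hqD.le hfar

theorem inner_fourier_add_ne_zero {κ W : ℝ} (hδ : IsNonresonant δ κ) {j : ℤ} (hj : j ≠ 0)
    (hv : IsFourierEigen δ q z v) (h0 : v ≠ 0) (hz : ‖z - ((j + δ) ^ 2 : ℝ)‖ ≤ W)
    (hW : W + 2 * ‖q‖ < κ / 2 * |(j : ℝ)|) {h : C(Circ, ℂ)} (hh : ‖h‖ ≤ 1 / 2) :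
    inner ℂ (circleL2 (fourier j + h)) (circleL2 v) ≠ 0 := by
  intro horth
  rw [map_add, inner_add_left] at horth
  have hcoeff : ‖circleCoeff j v‖ ≤ 1 / 2 * ‖circleL2 v‖ := by
    rw [show circleCoeff j v = _ from eq_neg_of_add_eq_zero_left horth, norm_neg]
    refine (norm_inner_le_norm _ _).trans ?_
    gcongr
    exact (norm_circleL2_le h).trans hh
  have hmass := hv.three_quarters_mul_le_norm_sq_circleCoeff hδ hj hz hW
  have hsq := pow_le_pow_left₀ (norm_nonneg _) hcoeff 2
  have hvpos : 0 < ‖circleL2 v‖ ^ 2 := pow_pos (norm_pos_iff.mpr (circleL2_ne_zero h0)) 2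
  rw [mul_pow] at hsq
  linarith

end IsFourierEigen

/-- The real eigenvalues of `(-i d/dθ + δ)² + q` on the circle. -/
def fourierSpectrum (δ : ℝ) (q : C(Circ, ℂ)) : Set ℝ :=
  {t | ∃ v, v ≠ 0 ∧ IsFourierEigen δ q t v}

section FourierSpectrum

variable {δ : ℝ} {q : C(Circ, ℂ)}

theorem exists_abs_sub_lt_of_mem_fourierSpectrum {t D : ℝ} (ht : t ∈ fourierSpectrum δ q)
    (hD : ‖q‖ < D) : ∃ n : ℤ, |t - ((n : ℝ) + δ) ^ 2| < D := by
  obtain ⟨v, h0, hv⟩ := ht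
  obtain ⟨n, hn⟩ := hv.exists_norm_sub_lt h0 hD
  rw [← Complex.ofReal_sub, Complex.norm_real] at hn
  exact ⟨n, hn⟩

theorem exists_norm_circleL2_eq_one_of_mem_fourierSpectrum {t : ℝ} (ht : t ∈ fourierSpectrum δ q) :
    ∃ v, ‖circleL2 v‖ = 1 ∧ IsFourierEigen δ q t v := by
  obtain ⟨v, h0, hv⟩ := ht
  refine ⟨((‖circleL2 v‖ : ℂ)⁻¹) • v, ?_, hv.smul _⟩
  rw [map_smul]
  exact norm_smul_inv_norm (circleL2_ne_zero h0)

theorem fourierSpectrum_inter_Iic_finite (hq : star q = q) (t₀ : ℝ) :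
    (fourierSpectrum δ q ∩ Set.Iic t₀).Finite := by
  set D : ℝ := 2 * ‖q‖ + 1
  have hD : 0 < D := by positivity
  have hlow : {n : ℤ | ((n : ℝ) + δ) ^ 2 < t₀ + D}.Finite := by
    simpa only [eventually_cofinite, not_le] using
      (tendsto_sq_int_add_cofinite δ).eventually_ge_atTop (t₀ + D)
  choose v hnorm heig using fun t : (fourierSpectrum δ q ∩ Set.Iic t₀ : Set ℝ) =>
    exists_norm_circleL2_eq_one_of_mem_fourierSpectrum t.2.1
  have horth : Orthonormal ℂ fun t => circleL2 (v t) :=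
    ⟨hnorm, fun s t hst => (heig s).inner_eq_zero hq (Subtype.coe_injective.ne hst) (heig t)⟩
  have hmass (t : (fourierSpectrum δ q ∩ Set.Iic t₀ : Set ℝ)) :
      3 / 4 ≤ ∑ n ∈ hlow.toFinset, ‖inner ℂ (circleL2 (v t)) (fourierLp 2 n)‖ ^ 2 := by
    have h := (heig t).three_quarters_mul_le_sum_norm_sq_circleCoeff hD (by simp [D])
      (F := hlow.toFinset) fun n hn => by
        rw [hlow.mem_toFinset, Set.mem_ofPred_eq, not_lt] at hn
        rw [← Complex.ofReal_sub, Complex.norm_real, Real.norm_eq_abs, abs_sub_comm]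
        exact (by linarith [t.2.2.out] : D ≤ _).trans (le_abs_self _)
    simp only [norm_inner_symm (circleL2 (v t))]
    rwa [hnorm, one_pow, mul_one] at h
  by_contra hinf
  have : Infinite (fourierSpectrum δ q ∩ Set.Iic t₀ : Set ℝ) := Set.infinite_coe_iff.mpr hinf
  obtain ⟨s, hs⟩ := Infinite.exists_subset_card_eq
    (fourierSpectrum δ q ∩ Set.Iic t₀ : Set ℝ) (2 * hlow.toFinset.card + 1)
  have hcard := card_mul_le_card_of_orthonormal horth (fun n => (orthonormal_fourier.1 n).le) s
    hlow.toFinset fun t _ => hmass t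
  rw [hs] at hcard
  push_cast at hcard
  linarith [(hlow.toFinset.card.cast_nonneg : (0 : ℝ) ≤ _)]

end FourierSpectrum

/-- The reduced resolvent of `(-i d/dθ + δ)²` at the eigenvalue `(j + δ)²`, an inverse of
`(j + δ)² - (-i d/dθ + δ)²` on the functions without `j`-th frequency. -/
def reducedResolvent (δ : ℝ) (j : ℤ) : C(Circ, ℂ) →L[ℂ] C(Circ, ℂ) :=
  fourierMultiplierCLM (resolventSymbol δ j)

section PerturbedEigenpair

variable {δ : ℝ} {j : ℤ} {p h : C(Circ, ℂ)}

theorem circleCoeff_reducedResolvent (δ : ℝ) (j n : ℤ) (u : C(Circ, ℂ)) :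
    circleCoeff n (reducedResolvent δ j u) = resolventCoeff δ j n * circleCoeff n u :=
  circleCoeff_fourierMultiplierCLM _ u n

theorem norm_reducedResolvent_le (δ : ℝ) (j : ℤ) : ‖reducedResolvent δ j‖ ≤ ‖resolventSymbol δ j‖ :=
  norm_fourierMultiplierCLM_le _

theorem norm_circleCoeff_mul_le (n : ℤ) (p v : C(Circ, ℂ)) : ‖circleCoeff n (p * v)‖ ≤ ‖p‖ * ‖v‖ :=
  (norm_circleCoeff_le _ n).trans ((norm_circleL2_le _).trans (norm_mul_le p v))

theorem exists_reducedResolvent_eq_self (hσ : 6 * ‖resolventSymbol δ j‖ * ‖p‖ ≤ 1) :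
    ∃ h, ‖h‖ ≤ 3 * ‖resolventSymbol δ j‖ * ‖p‖ ∧
      reducedResolvent δ j (p * fourier j + p * h - circleCoeff j (p * h) • h) = h := by
  set B := ContinuousLinearMap.mul ℂ C(Circ, ℂ) p
  have hB : ‖B‖ ≤ ‖p‖ := ContinuousLinearMap.opNorm_mul_apply_le ℂ _ p
  have hG := norm_reducedResolvent_le δ j
  have hℓ : ‖(circleCoeff j : C(Circ, ℂ) →L[ℂ] ℂ)‖ ≤ 1 :=
    ContinuousLinearMap.opNorm_le_bound _ zero_le_one fun v => by
      simpa only [one_mul, norm_one] using norm_circleCoeff_mul_le j 1 v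
  obtain ⟨h, hh, hfix⟩ := exists_lyapunovSchmidtMap_eq_self (G := reducedResolvent δ j) (B := B)
    hℓ (fourier_norm j).le ((by gcongr : 6 * ‖reducedResolvent δ j‖ * ‖B‖ ≤ _).trans hσ)
  exact ⟨h, hh.trans (by gcongr), hfix⟩

theorem circleCoeff_self_of_reducedResolvent_eq {u : C(Circ, ℂ)} (hh : reducedResolvent δ j u = h) :
    circleCoeff j h = 0 := by
  rw [← hh, circleCoeff_reducedResolvent, resolventCoeff_self, Complex.ofReal_zero, zero_mul]

theorem isFourierEigen_fourier_add {κ : ℝ} (hδ : IsNonresonant δ κ) (hj : j ≠ 0)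
    (hp : circleCoeff 0 p = 0)
    (hh : reducedResolvent δ j (p * fourier j + p * h - circleCoeff j (p * h) • h) = h) :
    IsFourierEigen δ p (((j + δ) ^ 2 : ℝ) + circleCoeff j (p * h)) (fourier j + h) := by
  have hhj := circleCoeff_self_of_reducedResolvent_eq hh
  set e := circleCoeff j (p * h)
  intro n
  rcases eq_or_ne n j with rfl | hn
  · rw [mul_add, map_add, map_add, circleCoeff_mul_fourier, circleCoeff_fourier, sub_self, hp, hhj,
      if_pos rfl]
    ring
  · have hgap : (((j + δ) ^ 2 - (n + δ) ^ 2 : ℝ) : ℂ) ≠ 0 :=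
      Complex.ofReal_ne_zero.mpr (abs_pos.mp (hδ.gap_pos hj hn))
    have hfix : circleCoeff n h = (((j + δ) ^ 2 - (n + δ) ^ 2 : ℝ) : ℂ)⁻¹
        * (circleCoeff n (p * (fourier j + h)) - e * circleCoeff n h) := by
      conv_lhs => rw [← hh, circleCoeff_reducedResolvent, resolventCoeff, Complex.ofReal_inv]
      rw [map_sub, map_smul, smul_eq_mul, mul_add]
    rw [eq_inv_mul_iff_mul_eq₀ hgap, Complex.ofReal_sub] at hfix
    rw [map_add, circleCoeff_fourier, if_neg hn, zero_add]
    linear_combination hfix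

theorem circleCoeff_mul_eq_inner (hp : star p = p) (j : ℤ) (v : C(Circ, ℂ)) :
    circleCoeff j (p * v) = inner ℂ (circleL2 (p * fourier j)) (circleL2 v) := by
  rw [inner_circleL2_mul, hp]
  rfl

theorem norm_circleCoeff_neg (hp : star p = p) (m : ℤ) :
    ‖circleCoeff (-m) p‖ = ‖circleCoeff m p‖ := by
  conv_rhs => rw [← hp, circleCoeff_star, RCLike.norm_conj]

theorem hasSum_circleCoeff_mul_reducedResolvent (hp : star p = p) (δ : ℝ) (j : ℤ) :
    HasSum (fun n => ((resolventCoeff δ j n * ‖circleCoeff (n - j) p‖ ^ 2 : ℝ) : ℂ))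
      (circleCoeff j (p * reducedResolvent δ j (p * fourier j))) := by
  rw [circleCoeff_mul_eq_inner hp]
  refine (hasSum_inner_circleCoeff _ _).congr_fun fun n => ?_
  rw [circleCoeff_reducedResolvent, circleCoeff_mul_fourier, mul_left_comm, Complex.conj_mul']
  push_cast
  rfl

/-- The second order term of the perturbation series of the eigenvalue: pairing the frequencies
`j + m` and `j - m` gains a factor `1 / j` over the size of the reduced resolvent. -/
theorem norm_circleCoeff_mul_reducedResolvent_le {κ B : ℝ} (hδ : IsNonresonant δ κ) (hj : j ≠ 0)
    (hp : star p = p) (hB : ∀ m : ℤ, |(m : ℝ)| * ‖circleCoeff m p‖ ≤ B) :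
    ‖circleCoeff j (p * reducedResolvent δ j (p * fourier j))‖
      ≤ B ^ 2 * ‖resolventSymbol δ j‖ ^ 2 := by
  have hterm := hasSum_circleCoeff_mul_reducedResolvent hp δ j
  have hsq := (summable_sq_resolventCoeff δ j).hasSum
  rw [tsum_sq_resolventCoeff] at hsq
  have hpaired := ((Equiv.addLeft j).hasSum_iff.mpr hterm).add
    ((Equiv.subLeft j).hasSum_iff.mpr hterm)
  have hmaj := (((Equiv.addLeft j).hasSum_iff.mpr hsq).add
    ((Equiv.subLeft j).hasSum_iff.mpr hsq)).mul_left (B ^ 2)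
  have hle := hpaired.norm_le_of_bounded hmaj fun m => ?_
  · rw [← two_mul, norm_mul, Complex.norm_two] at hle
    linarith
  · simp only [Function.comp_apply, Equiv.coe_addLeft, Equiv.subLeft_apply, add_sub_cancel_left,
      sub_sub_cancel_left, norm_circleCoeff_neg hp]
    rw [← Complex.ofReal_add, ← add_mul, Complex.norm_real, norm_mul, Real.norm_eq_abs,
      Real.norm_of_nonneg (sq_nonneg _)]
    have hdecay : (m : ℝ) ^ 2 * ‖circleCoeff m p‖ ^ 2 ≤ B ^ 2 := by
      rw [← sq_abs (m : ℝ), ← mul_pow]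
      exact pow_le_pow_left₀ (by positivity) (hB m) 2
    calc _ ≤ (m : ℝ) ^ 2 * (resolventCoeff δ j (j + m) ^ 2 + resolventCoeff δ j (j - m) ^ 2)
          * ‖circleCoeff m p‖ ^ 2 := by gcongr; exact hδ.abs_resolventCoeff_add_le hj m
      _ = (m : ℝ) ^ 2 * ‖circleCoeff m p‖ ^ 2
          * (resolventCoeff δ j (j + m) ^ 2 + resolventCoeff δ j (j - m) ^ 2) := by ring
      _ ≤ _ := by gcongr

theorem norm_circleCoeff_mul_le_of_reducedResolvent_eq {κ B : ℝ} (hδ : IsNonresonant δ κ)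
    (hj : j ≠ 0) (hp : star p = p) (hB : ∀ m : ℤ, |(m : ℝ)| * ‖circleCoeff m p‖ ≤ B)
    (hle : ‖h‖ ≤ 1)
    (hh : reducedResolvent δ j (p * fourier j + p * h - circleCoeff j (p * h) • h) = h) :
    ‖circleCoeff j (p * h)‖
      ≤ B ^ 2 * ‖resolventSymbol δ j‖ ^ 2 + 2 * ‖p‖ ^ 2 * ‖resolventSymbol δ j‖ * ‖h‖ := by
  set e := circleCoeff j (p * h)
  have he : ‖e‖ ≤ ‖p‖ * ‖h‖ := norm_circleCoeff_mul_le j p h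
  have hremainder : ‖p * h - e • h‖ ≤ 2 * ‖p‖ * ‖h‖ := by
    have hsmul : ‖e • h‖ ≤ ‖p‖ * ‖h‖ :=
      (norm_smul_le e h).trans ((mul_le_of_le_one_right (norm_nonneg e) hle).trans he)
    linarith [norm_sub_le (p * h) (e • h), norm_mul_le p h]
  have hsplit : e = circleCoeff j (p * reducedResolvent δ j (p * fourier j))
      + circleCoeff j (p * reducedResolvent δ j (p * h - e • h)) := by
    rw [← map_add, ← mul_add, ← map_add, ← add_sub_assoc, hh]
  have hsecond : ‖circleCoeff j (p * reducedResolvent δ j (p * h - e • h))‖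
      ≤ ‖p‖ * (‖resolventSymbol δ j‖ * (2 * ‖p‖ * ‖h‖)) := by
    refine (norm_circleCoeff_mul_le j p _).trans ?_
    gcongr
    exact (reducedResolvent δ j).le_of_opNorm_le_of_le (norm_reducedResolvent_le δ j) hremainder
  calc ‖e‖ ≤ B ^ 2 * ‖resolventSymbol δ j‖ ^ 2
        + ‖p‖ * (‖resolventSymbol δ j‖ * (2 * ‖p‖ * ‖h‖)) := by
        rw [hsplit]
        exact norm_add_le_of_le (norm_circleCoeff_mul_reducedResolvent_le hδ hj hp hB) hsecond
    _ = _ := by ring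

theorem exists_isFourierEigen_fourier_add {κ B : ℝ} (hδ : IsNonresonant δ κ) (hj : j ≠ 0)
    (hp : star p = p) (hp0 : circleCoeff 0 p = 0)
    (hB : ∀ m : ℤ, |(m : ℝ)| * ‖circleCoeff m p‖ ≤ B)
    (hσ : 6 * ‖resolventSymbol δ j‖ * ‖p‖ ≤ 1) :
    ∃ (ε : ℝ) (h : C(Circ, ℂ)), ‖h‖ ≤ 3 * ‖resolventSymbol δ j‖ * ‖p‖ ∧
      |ε| ≤ (B ^ 2 + 6 * ‖p‖ ^ 3) * ‖resolventSymbol δ j‖ ^ 2 ∧ circleCoeff j h = 0 ∧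
      IsFourierEigen δ p (((j + δ) ^ 2 + ε : ℝ) : ℂ) (fourier j + h) := by
  obtain ⟨h, hnorm, hh⟩ := exists_reducedResolvent_eq_self hσ
  have hhj := circleCoeff_self_of_reducedResolvent_eq hh
  have heig := isFourierEigen_fourier_add hδ hj hp0 hh
  have hbound :=
    norm_circleCoeff_mul_le_of_reducedResolvent_eq hδ hj hp hB (hnorm.trans (by linarith)) hh
  have hreal := heig.conj_eq hp (fourier_add_ne_zero hhj)
  rw [map_add, Complex.conj_ofReal, add_right_inj] at hreal
  obtain ⟨ε, hε⟩ := Complex.conj_eq_iff_real.mp hreal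
  rw [hε, Complex.norm_real, Real.norm_eq_abs] at hbound
  refine ⟨ε, h, hnorm, hbound.trans ?_, hhj, ?_⟩
  · calc _ ≤ B ^ 2 * ‖resolventSymbol δ j‖ ^ 2 + 2 * ‖p‖ ^ 2 * ‖resolventSymbol δ j‖
          * (3 * ‖resolventSymbol δ j‖ * ‖p‖) := by gcongr
      _ = _ := by ring
  · rwa [Complex.ofReal_add, ← hε]

theorem eventually_exists_isFourierEigen_fourier_add {κ B c : ℝ} (hδ : IsNonresonant δ κ)
    {q : C(Circ, ℂ)} (hq : star q = q) (hc : circleCoeff 0 q = c)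
    (hB : ∀ m : ℤ, |(m : ℝ)| * ‖circleCoeff m q‖ ≤ B) :
    ∃ C : ℝ, ∀ᶠ j : ℤ in cofinite, ∃ (ε : ℝ) (h : C(Circ, ℂ)),
      ‖h‖ ≤ C / |(j : ℝ)| ∧ |ε| ≤ C / |(j : ℝ)| ^ 2 ∧ circleCoeff j h = 0 ∧
      IsFourierEigen δ q ((c + (j + δ) ^ 2 + ε : ℝ) : ℂ) (fourier j + h) := by
  obtain ⟨C₀, hσ⟩ := hδ.exists_norm_resolventSymbol_le
  set p : C(Circ, ℂ) := q - (c : ℂ) • 1 with hp_def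
  have hcoeff (m : ℤ) : circleCoeff m p = if m = 0 then 0 else circleCoeff m q := by
    rw [hp_def, map_sub, map_smul, ← fourier_zero_eq_one, circleCoeff_fourier]
    split_ifs with hm
    · rw [hm, hc, smul_eq_mul, mul_one, sub_self]
    · rw [smul_zero, sub_zero]
  have hp : star p = p := by
    rw [hp_def, star_sub, hq, star_smul, star_one, RCLike.star_def, Complex.conj_ofReal]
  have hpB (m : ℤ) : |(m : ℝ)| * ‖circleCoeff m p‖ ≤ B := by
    refine le_trans ?_ (hB m)
    rw [hcoeff]
    split_ifs with hm <;> simp [hm]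
  refine ⟨max (3 * C₀ * ‖p‖) ((B ^ 2 + 6 * ‖p‖ ^ 3) * C₀ ^ 2), ?_⟩
  have hlarge : ∀ᶠ j : ℤ in cofinite, 6 * C₀ * ‖p‖ ≤ |(j : ℝ)| :=
    (tendsto_norm_cocompact_atTop.comp Int.tendsto_coe_cofinite).eventually_ge_atTop _
  filter_upwards [hlarge, eventually_cofinite_ne 0] with j hj hj0
  have hjpos : 0 < |(j : ℝ)| := abs_pos.mpr (Int.cast_ne_zero.mpr hj0)
  have hsmall : 6 * (C₀ / |(j : ℝ)|) * ‖p‖ ≤ 1 := by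
    rwa [mul_div_assoc', div_mul_eq_mul_div, div_le_one hjpos]
  obtain ⟨ε, h, hh, hε, hhj, heig⟩ := exists_isFourierEigen_fourier_add hδ hj0 hp
    (by rw [hcoeff, if_pos rfl]) hpB ((by gcongr; exact hσ j hj0 : _ ≤ _).trans hsmall)
  refine ⟨ε, h, hh.trans ?_, hε.trans ?_, hhj, ?_⟩
  · calc _ ≤ 3 * (C₀ / |(j : ℝ)|) * ‖p‖ := by gcongr; exact hσ j hj0
      _ = 3 * C₀ * ‖p‖ / |(j : ℝ)| := by ring
      _ ≤ _ := by gcongr; exact le_max_left _ _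
  · calc _ ≤ (B ^ 2 + 6 * ‖p‖ ^ 3) * (C₀ / |(j : ℝ)|) ^ 2 := by gcongr; exact hσ j hj0
      _ = (B ^ 2 + 6 * ‖p‖ ^ 3) * C₀ ^ 2 / |(j : ℝ)| ^ 2 := by ring
      _ ≤ _ := by gcongr; exact le_max_right _ _
  · have hshift := heig.add_const c
    rw [hp_def, sub_add_cancel, ← Complex.ofReal_add] at hshift
    rwa [add_assoc, add_comm c]

end PerturbedEigenpair

/-- The continuous function on the circle given by a continuous periodic function. -/
def periodicLift {T : ℝ} {f : ℝ → ℂ} (hp : Function.Periodic f T) (hc : Continuous f) :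
    C(AddCircle T, ℂ) :=
  ⟨hp.lift, continuous_coinduced_dom.mpr hc⟩

theorem periodic_circle_coe {T : ℝ} {E : Type*} (v : AddCircle T → E) :
    Function.Periodic (fun θ : ℝ => v θ) T :=
  fun θ => congrArg v (AddCircle.coe_add_period T θ)

theorem circle_ext {T : ℝ} {v w : C(AddCircle T, ℂ)} (h : ∀ θ : ℝ, v θ = w θ) : v = w :=
  ContinuousMap.ext fun x => QuotientAddGroup.induction_on x h

theorem circleCoeff_of_hasDerivAt {T : ℝ} [hT : Fact (0 < T)] {v w : C(AddCircle T, ℂ)}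
    (h : ∀ θ : ℝ, HasDerivAt (fun θ : ℝ => v θ) (w θ) θ) (n : ℤ) :
    circleCoeff n w = 2 * Real.pi * Complex.I * n / T * circleCoeff n v := by
  have hcont (u : C(AddCircle T, ℂ)) : Continuous fun θ : ℝ => u θ :=
    u.continuous.comp (AddCircle.continuous_mk' T)
  have hparts := intervalIntegral.integral_mul_deriv_eq_deriv_mul (a := 0) (b := T)
    (fun θ _ => hasDerivAt_fourier_neg T n θ) (fun θ _ => h θ)
    (((hcont (fourier (-n))).const_mul _).intervalIntegrable _ _)
    ((hcont w).intervalIntegrable _ _)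
  simp only [circleCoeff_eq_fourierCoeff, fourierCoeff_eq_intervalIntegral _ n 0, zero_add,
    smul_eq_mul, hparts, AddCircle.coe_period, QuotientAddGroup.mk_zero, sub_self, zero_sub,
    mul_assoc (_ / _ : ℂ), intervalIntegral.integral_const_mul, Complex.real_smul]
  ring

section MagneticDerivative

variable {A : ℝ → ℝ} {f g : ℝ → ℂ}

theorem hasDerivAt_of_magneticDeriv (hf : Differentiable ℝ f) (θ : ℝ) :
    HasDerivAt f (Complex.I * (magneticDeriv A f θ - A θ * f θ)) θ := by
  refine (hf θ).hasDerivAt.congr_deriv ?_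
  rw [magneticDeriv]
  linear_combination deriv f θ * Complex.I_sq

theorem magneticDeriv_eq_of_hasDerivAt {w : ℂ} {θ : ℝ}
    (h : HasDerivAt f (Complex.I * (w - A θ * f θ)) θ) : magneticDeriv A f θ = w := by
  rw [magneticDeriv, h.deriv]
  linear_combination (A θ * f θ - w) * Complex.I_sq

theorem magneticDeriv_sub_mul (c : ℂ) (hf : Differentiable ℝ f) (hg : Differentiable ℝ g) :
    magneticDeriv A (fun θ => g θ - c * f θ)
      = fun θ => magneticDeriv A g θ - c * magneticDeriv A f θ := by
  funext θ
  rw [magneticDeriv, deriv_fun_sub (hg θ) ((hf θ).const_mul c), deriv_const_mul c (hf θ)]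
  simp only [magneticDeriv]
  ring

theorem magneticDeriv_periodic {T : ℝ} (hA : Function.Periodic A T) (hf : Function.Periodic f T) :
    Function.Periodic (magneticDeriv A f) T := fun θ => by
  have hderiv : deriv f (θ + T) = deriv f θ := by
    rw [← deriv_comp_add_const, funext hf]
  simp only [magneticDeriv, hderiv, hA θ, hf θ]

end MagneticDerivative

theorem hasDerivAt_exp_I_mul (a θ : ℝ) :
    HasDerivAt (fun x : ℝ => Complex.exp (Complex.I * (a * x : ℝ)))
      (Complex.I * a * Complex.exp (Complex.I * (a * θ : ℝ))) θ := by
  have hexp := ((((hasDerivAt_id θ).const_mul a).ofReal_comp.const_mul Complex.I).cexp)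
  simpa [mul_comm, mul_left_comm] using hexp

theorem exp_I_mul_add_two_pi (a θ : ℝ) :
    Complex.exp (Complex.I * (a * (θ + 2 * Real.pi) : ℝ))
      = Complex.exp (Complex.I * (a * (2 * Real.pi) : ℝ))
        * Complex.exp (Complex.I * (a * θ : ℝ)) := by
  rw [← Complex.exp_add, ← mul_add, ← Complex.ofReal_add, mul_add a, add_comm]

theorem exp_two_pi_mul_ne_one {a : ℝ} (ha : ∀ m : ℤ, a ≠ m) :
    Complex.exp (Complex.I * (a * (2 * Real.pi) : ℝ)) ≠ 1 := fun h => by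
  obtain ⟨m, hm⟩ := Complex.exp_eq_one_iff.mp h
  refine ha m (Complex.ofReal_injective (mul_left_cancel₀ Complex.two_pi_I_ne_zero ?_))
  push_cast at hm ⊢
  linear_combination hm

theorem exists_quasiperiodic_hasDerivAt {T : ℝ} {F : ℝ → ℂ} {μ : ℂ} (hμ : μ ≠ 1)
    (hF : Continuous F) (hper : ∀ x, F (x + T) = μ * F x) :
    ∃ G : ℝ → ℂ, (∀ x, HasDerivAt G (F x) x) ∧ ∀ x, G (x + T) = μ * G x := by
  set G₀ : ℝ → ℂ := fun x => ∫ s in (0 : ℝ)..x, F s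
  have hG₀ (x : ℝ) : HasDerivAt G₀ (F x) x := (hF.integral_hasStrictDerivAt 0 x).hasDerivAt
  have hdefect (x : ℝ) : HasDerivAt (fun y => G₀ (y + T) - μ * G₀ y) 0 x :=
    (((hG₀ (x + T)).comp_add_const x T).sub ((hG₀ x).const_mul μ)).congr_deriv
      (by rw [hper, sub_self])
  have hconst (x : ℝ) := is_const_of_deriv_eq_zero (fun y => (hdefect y).differentiableAt)
    (fun y => (hdefect y).deriv) x 0
  refine ⟨fun x => G₀ x + (G₀ (0 + T) - μ * G₀ 0) / (μ - 1), fun x => (hG₀ x).add_const _,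
    fun x => ?_⟩
  rw [← hconst x]
  field_simp [sub_ne_zero.mpr hμ]
  ring

section CircleSolution

variable {δ t : ℝ} {q v w : C(Circ, ℂ)} {f g : ℝ → ℂ}

theorem circleCoeff_of_magneticDeriv_eq (hv : Differentiable ℝ fun θ : ℝ => v θ)
    (hw : ∀ θ : ℝ, magneticDeriv (fun _ => δ) (fun θ : ℝ => v θ) θ = w θ) (n : ℤ) :
    circleCoeff n w = (n + δ) * circleCoeff n v := by
  have hderiv := circleCoeff_of_hasDerivAt (v := v) (w := Complex.I • (w - (δ : ℂ) • v))
    (fun θ => (hasDerivAt_of_magneticDeriv hv θ).congr_deriv (by rw [hw]; rfl)) n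
  have hpi : (Real.pi : ℂ) ≠ 0 := Complex.ofReal_ne_zero.mpr Real.pi_ne_zero
  simp only [map_smul, map_sub, smul_eq_mul] at hderiv
  push_cast at hderiv
  field_simp at hderiv
  linear_combination hderiv

theorem exists_magneticDeriv_eq (hδ : ∀ m : ℤ, δ ≠ m) (w : C(Circ, ℂ)) :
    ∃ v : C(Circ, ℂ), Differentiable ℝ (fun θ : ℝ => v θ) ∧
      ∀ θ : ℝ, magneticDeriv (fun _ => δ) (fun θ : ℝ => v θ) θ = w θ := by
  obtain ⟨G, hG, hper⟩ := exists_quasiperiodic_hasDerivAt (T := 2 * Real.pi)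
    (F := fun θ => Complex.I * Complex.exp (Complex.I * (δ * θ : ℝ)) * w θ)
    (exp_two_pi_mul_ne_one hδ)
    (.mul (by fun_prop) (w.continuous.comp (AddCircle.continuous_mk' _))) fun θ => by
      rw [exp_I_mul_add_two_pi, AddCircle.coe_add_period]
      ring
  set f : ℝ → ℂ := fun θ => (Complex.exp (Complex.I * (δ * θ : ℝ)))⁻¹ * G θ with hf_def
  have hf (θ : ℝ) : HasDerivAt f (Complex.I * (w θ - δ * f θ)) θ := by
    refine (((hasDerivAt_exp_I_mul δ θ).fun_inv (Complex.exp_ne_zero _)).mul (hG θ)).congr_deriv ?_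
    simp only [hf_def]
    field_simp [Complex.exp_ne_zero]
    ring
  have hdiff : Differentiable ℝ f := fun θ => (hf θ).differentiableAt
  have hfper : Function.Periodic f (2 * Real.pi) := fun θ => by
    simp only [hf_def]
    rw [hper, exp_I_mul_add_two_pi]
    field_simp [Complex.exp_ne_zero]
  exact ⟨periodicLift hfper hdiff.continuous, hdiff,
    fun θ => magneticDeriv_eq_of_hasDerivAt (A := fun _ => δ) (hf θ)⟩

/-- `f` is a classical solution of `(-i d/dθ + δ)² f + q f = t f`. -/
def IsCircleSolution (δ : ℝ) (q : C(Circ, ℂ)) (t : ℝ) (f : ℝ → ℂ) : Prop :=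
  Differentiable ℝ f ∧ Differentiable ℝ (magneticDeriv (fun _ => δ) f) ∧
  ∀ θ : ℝ, magneticDeriv (fun _ => δ) (magneticDeriv (fun _ => δ) f) θ + q θ * f θ = t * f θ

theorem IsFourierEigen.isCircleSolution (hδ : ∀ m : ℤ, δ ≠ m) (h : IsFourierEigen δ q t v) :
    IsCircleSolution δ q t (fun θ : ℝ => v θ) := by
  obtain ⟨w₁, hw₁, heq₁⟩ := exists_magneticDeriv_eq hδ ((t : ℂ) • v - q * v)
  obtain ⟨w₂, hw₂, heq₂⟩ := exists_magneticDeriv_eq hδ w₁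
  have hvw : v = w₂ := eq_of_circleCoeff_eq fun n => by
    have hn : (n + δ : ℂ) ≠ 0 := fun h0 => hδ (-n) (Complex.ofReal_injective (by
      push_cast
      linear_combination h0))
    have hcoeff := circleCoeff_of_magneticDeriv_eq hw₁ heq₁ n
    rw [circleCoeff_of_magneticDeriv_eq hw₂ heq₂ n, map_sub, map_smul, smul_eq_mul, ← h n] at hcoeff
    refine mul_left_cancel₀ (pow_ne_zero 2 hn) ?_
    push_cast at hcoeff
    linear_combination hcoeff
  subst hvw
  refine ⟨hw₂, by rwa [funext heq₂], fun θ => ?_⟩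
  rw [funext heq₂, heq₁]
  exact sub_add_cancel ((t : ℂ) * v θ) (q θ * v θ)

theorem IsCircleSolution.isFourierEigen (h : IsCircleSolution δ q t fun θ : ℝ => v θ) :
    IsFourierEigen δ q t v := fun n => by
  obtain ⟨hv, hDv, heq⟩ := h
  set w : C(Circ, ℂ) := periodicLift
    (magneticDeriv_periodic (fun _ => rfl) (periodic_circle_coe v)) hDv.continuous
  have hvw := circleCoeff_of_magneticDeriv_eq (w := w) hv (fun _ => rfl) n
  have hcoeff := circleCoeff_of_magneticDeriv_eq (v := w) (w := (t : ℂ) • v - q * v) hDv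
    (fun θ => eq_sub_of_add_eq (heq θ)) n
  rw [map_sub, map_smul, smul_eq_mul, hvw] at hcoeff
  push_cast
  linear_combination hcoeff

theorem IsCircleSolution.hasDerivAt (h : IsCircleSolution δ q t f) (θ : ℝ) :
    HasDerivAt f (Complex.I * (magneticDeriv (fun _ => δ) f θ - δ * f θ)) θ :=
  hasDerivAt_of_magneticDeriv h.1 θ

theorem IsCircleSolution.hasDerivAt_magneticDeriv (h : IsCircleSolution δ q t f) (θ : ℝ) :
    HasDerivAt (magneticDeriv (fun _ => δ) f)
      (Complex.I * ((t - q θ) * f θ - δ * magneticDeriv (fun _ => δ) f θ)) θ := by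
  refine (hasDerivAt_of_magneticDeriv (A := fun _ => δ) h.2.1 θ).congr_deriv ?_
  linear_combination Complex.I * h.2.2 θ

theorem IsCircleSolution.eq_zero (h : IsCircleSolution δ q t f)
    (hp : Function.Periodic f (2 * Real.pi)) {x : ℝ} (hf : f x = 0)
    (hDf : magneticDeriv (fun _ => δ) f x = 0) (y : ℝ) : f y = 0 := by
  set g := magneticDeriv (fun _ => δ) f
  set p : C(Circ, ℂ) := (t : ℂ) • 1 - q with hp_def
  have hpθ (θ : ℝ) : p θ = t - q θ := by simp [hp_def]
  have hderiv (θ : ℝ) : HasDerivAt (fun θ => (f θ, g θ))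
      (Complex.I * (g θ - δ * f θ), Complex.I * (p θ * f θ - δ * g θ)) θ := by
    rw [hpθ]
    exact (h.hasDerivAt θ).prodMk (h.hasDerivAt_magneticDeriv θ)
  have hbound {a b : ℂ} {M X : ℝ} (ha : ‖a‖ ≤ M * X) (hb : ‖b‖ ≤ X) :
      ‖Complex.I * (a - δ * b)‖ ≤ (M + |δ|) * X := by
    rw [norm_mul, Complex.norm_I, one_mul, add_mul]
    exact norm_sub_le_of_le ha (norm_mul_le_of_le (Complex.norm_real δ).le hb)
  have hzero := eq_zero_of_abs_deriv_le_mul_abs_self_of_eq_zero_right (a := x)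
    (b := x + 2 * Real.pi) (K := max 1 ‖p‖ + |δ|)
    (fun θ _ => (hderiv θ).continuousAt.continuousWithinAt)
    (fun θ _ => (hderiv θ).hasDerivWithinAt) (Prod.ext hf hDf) (fun θ _ => ?_)
  · obtain ⟨z, hz, hzy⟩ := hp.exists_mem_Ico Real.two_pi_pos y x
    rw [hzy]
    exact congrArg Prod.fst (hzero z (Set.Ico_subset_Icc_self hz))
  · refine max_le (hbound ?_ (norm_fst_le (f θ, g θ))) (hbound ?_ (norm_snd_le (f θ, g θ)))
    · rw [← one_mul ‖g θ‖]
      exact mul_le_mul (le_max_left _ _) (norm_snd_le (f θ, g θ)) (norm_nonneg _) (by positivity)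
    · exact norm_mul_le_of_le ((p.norm_coe_le_norm θ).trans (le_max_right _ _))
        (norm_fst_le (f θ, g θ))

theorem IsCircleSolution.sub_mul (hf : IsCircleSolution δ q t f) (hg : IsCircleSolution δ q t g)
    (c : ℂ) : IsCircleSolution δ q t (fun θ => g θ - c * f θ) := by
  have hD := magneticDeriv_sub_mul (A := fun _ => δ) c hf.1 hg.1
  refine ⟨hg.1.sub (hf.1.const_mul c), ?_, fun θ => ?_⟩
  · rw [hD]
    exact hg.2.1.sub (hf.2.1.const_mul c)
  · rw [hD, magneticDeriv_sub_mul c hf.2.1 hg.2.1]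
    linear_combination hg.2.2 θ - c * hf.2.2 θ

/-- The Wronskian `W` of two periodic solutions satisfies `W' = -2iδW`, so that
`exp (2iδθ) W` is constant, while `W` is periodic. -/
theorem IsCircleSolution.wronskian_eq_zero (hδ : ∀ m : ℤ, 2 * δ ≠ m)
    (hf : IsCircleSolution δ q t f) (hg : IsCircleSolution δ q t g)
    (hfp : Function.Periodic f (2 * Real.pi)) (hgp : Function.Periodic g (2 * Real.pi)) (x : ℝ) :
    f x * magneticDeriv (fun _ => δ) g x - g x * magneticDeriv (fun _ => δ) f x = 0 := by
  set W : ℝ → ℂ := fun θ =>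
    f θ * magneticDeriv (fun _ => δ) g θ - g θ * magneticDeriv (fun _ => δ) f θ with hW_def
  have hW (θ : ℝ) : HasDerivAt W (-(2 * δ * Complex.I) * W θ) θ := by
    refine (((hf.hasDerivAt θ).mul (hg.hasDerivAt_magneticDeriv θ)).sub
      ((hg.hasDerivAt θ).mul (hf.hasDerivAt_magneticDeriv θ))).congr_deriv ?_
    simp only [hW_def]
    ring
  have hexpW (θ : ℝ) :
      HasDerivAt (fun θ => Complex.exp (Complex.I * (2 * δ * θ : ℝ)) * W θ) 0 θ := by
    refine ((hasDerivAt_exp_I_mul (2 * δ) θ).mul (hW θ)).congr_deriv ?_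
    push_cast
    ring
  have hWp : W (x + 2 * Real.pi) = W x := by
    simp only [hW_def, hfp x, hgp x, magneticDeriv_periodic (A := fun _ => δ) (fun _ => rfl) hfp x,
      magneticDeriv_periodic (A := fun _ => δ) (fun _ => rfl) hgp x]
  have hconst := is_const_of_deriv_eq_zero (fun θ => (hexpW θ).differentiableAt)
    (fun θ => (hexpW θ).deriv) (x + 2 * Real.pi) x
  rw [hWp, exp_I_mul_add_two_pi, mul_assoc, mul_left_eq_self₀] at hconst
  exact (mul_eq_zero.mp (hconst.resolve_left (exp_two_pi_mul_ne_one hδ))).resolve_left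
    (Complex.exp_ne_zero _)

theorem IsCircleSolution.exists_eq_smul (hδ : ∀ m : ℤ, 2 * δ ≠ m)
    (hv : IsCircleSolution δ q t (fun θ : ℝ => v θ))
    (hw : IsCircleSolution δ q t (fun θ : ℝ => w θ)) (hv0 : v ≠ 0) : ∃ c : ℂ, w = c • v := by
  obtain ⟨x, hx⟩ : ∃ x : ℝ, v x ≠ 0 := by
    by_contra! hzero
    exact hv0 (circle_ext hzero)
  have hwronskian :=
    hv.wronskian_eq_zero hδ hw (periodic_circle_coe v) (periodic_circle_coe w) x
  refine ⟨w x / v x, circle_ext fun θ => sub_eq_zero.mp ?_⟩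
  refine (hv.sub_mul hw (w x / v x)).eq_zero
    (periodic_circle_coe (w - (w x / v x) • v)) (x := x) ?_ ?_ θ
  · rw [div_mul_cancel₀ _ hx, sub_self]
  · rw [magneticDeriv_sub_mul _ hv.1 hw.1]
    field_simp
    linear_combination hwronskian

end CircleSolution

theorem pt_periodic : Function.Periodic pt (2 * Real.pi) := fun θ => by
  simp [pt]

theorem lipschitzWith_pt : LipschitzWith 1 pt := LipschitzWith.of_dist_le_mul fun s t => by
  rw [Subtype.dist_eq, EuclideanSpace.dist_eq, NNReal.coe_one, one_mul, Real.dist_eq]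
  refine Real.sqrt_le_iff.mpr ⟨abs_nonneg _, ?_⟩
  have hcos := Real.one_sub_sq_div_two_le_cos (x := s - t)
  rw [Real.cos_sub] at hcos
  simp only [pt, Fin.sum_univ_two, Real.dist_eq, sq_abs, PiLp.toLp_apply, Matrix.cons_val_zero,
    Matrix.cons_val_one]
  linarith [Real.sin_sq_add_cos_sq s, Real.sin_sq_add_cos_sq t]

theorem pt_surjective : Function.Surjective pt := fun ω => by
  set z : ℂ := ⟨(ω : Plane) 0, (ω : Plane) 1⟩
  have hz : ‖z‖ = 1 := by
    rw [← norm_eq_of_mem_sphere ω, EuclideanSpace.norm_eq, Complex.norm_eq_sqrt_sq_add_sq]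
    simp [z]
  refine ⟨Complex.arg z, Subtype.ext (PiLp.ext fun i => ?_)⟩
  fin_cases i
  · have hcos := Complex.cos_arg (norm_pos_iff.mp (hz.trans_gt one_pos))
    rwa [hz, div_one] at hcos
  · have hsin := Complex.sin_arg z
    rwa [hz, div_one] at hsin

theorem exists_int_of_pt_eq {s t : ℝ} (h : pt s = pt t) : ∃ n : ℤ, s = t + n * (2 * Real.pi) := by
  have hcoord (i : Fin 2) := congrArg (fun ω : UnitCircle => (ω : Plane) i) h
  have hangle := Real.Angle.cos_sin_inj (hcoord 0) (hcoord 1)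
  obtain ⟨n, hn⟩ := Real.Angle.angle_eq_iff_two_pi_dvd_sub.mp hangle
  exact ⟨n, by linarith⟩

theorem exists_comp_pt_eq_of_periodic {α : Type*} {f : ℝ → α}
    (hf : Function.Periodic f (2 * Real.pi)) : ∃ ψ : UnitCircle → α, ∀ θ, ψ (pt θ) = f θ := by
  choose angle hangle using pt_surjective
  refine ⟨fun ω => f (angle ω), fun θ => ?_⟩
  obtain ⟨n, hn⟩ := exists_int_of_pt_eq (hangle (pt θ))
  exact (congrArg f hn).trans (hf.int_mul n θ)

theorem continuous_angularComponent {Avec : UnitCircle → Plane} (hA : Continuous Avec) :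
    Continuous (angularComponent Avec) := by
  have htangent : Continuous tangent := by
    unfold tangent
    fun_prop
  exact (hA.comp lipschitzWith_pt.continuous).inner htangent

theorem periodic_angularComponent (Avec : UnitCircle → Plane) :
    Function.Periodic (angularComponent Avec) (2 * Real.pi) := fun θ => by
  simp [angularComponent, tangent, pt_periodic θ]

/-- The unimodular factor turning the field `A` into the constant field `δ`. -/
def gaugeFactor (A : ℝ → ℝ) (δ θ : ℝ) : ℂ :=
  Complex.exp (-Complex.I * (((∫ t in (0 : ℝ)..θ, A t) - δ * θ : ℝ) : ℂ))

section GaugeFactor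

variable {A : ℝ → ℝ} {f : ℝ → ℂ}

theorem gaugeFactor_ne_zero (A : ℝ → ℝ) (δ θ : ℝ) : gaugeFactor A δ θ ≠ 0 := Complex.exp_ne_zero _

theorem norm_gaugeFactor (A : ℝ → ℝ) (δ θ : ℝ) : ‖gaugeFactor A δ θ‖ = 1 := by
  rw [gaugeFactor, neg_mul, ← mul_neg, ← Complex.ofReal_neg, mul_comm,
    Complex.norm_exp_ofReal_mul_I]

theorem hasDerivAt_gaugeFactor (hA : Continuous A) (δ θ : ℝ) :
    HasDerivAt (gaugeFactor A δ) (-Complex.I * (A θ - δ : ℝ) * gaugeFactor A δ θ) θ := by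
  have hphase : HasDerivAt (fun θ : ℝ => (∫ t in (0 : ℝ)..θ, A t) - δ * θ) (A θ - δ) θ :=
    ((hA.integral_hasStrictDerivAt 0 θ).hasDerivAt.fun_sub
      ((hasDerivAt_id θ).const_mul δ)).congr_deriv (by rw [mul_one])
  exact (hphase.ofReal_comp.const_mul (-Complex.I)).cexp.congr_deriv (mul_comm _ _)

theorem gaugeFactor_periodic (hA : Continuous A) (hp : Function.Periodic A (2 * Real.pi))
    {δ : ℝ} {m : ℤ} (hm : average A = δ + m) :
    Function.Periodic (gaugeFactor A δ) (2 * Real.pi) := fun θ => by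
  have hint : ∫ t in (0 : ℝ)..(θ + 2 * Real.pi), A t
      = (∫ t in (0 : ℝ)..θ, A t) + 2 * Real.pi * (δ + m) := by
    rw [← intervalIntegral.integral_add_adjacent_intervals (hA.intervalIntegrable 0 θ)
      (hA.intervalIntegrable θ _), hp.intervalIntegral_add_eq θ 0, zero_add, ← hm, average]
    field_simp
  rw [gaugeFactor, hint, gaugeFactor, Complex.exp_eq_exp_iff_exists_int]
  refine ⟨-m, ?_⟩
  push_cast
  ring

theorem magneticDeriv_gaugeFactor (hA : Continuous A) (δ : ℝ) (hf : Differentiable ℝ f) :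
    magneticDeriv A (fun θ => gaugeFactor A δ θ * f θ)
      = fun θ => gaugeFactor A δ θ * magneticDeriv (fun _ => δ) f θ := by
  funext θ
  refine magneticDeriv_eq_of_hasDerivAt (((hasDerivAt_gaugeFactor hA δ θ).mul
    (hasDerivAt_of_magneticDeriv (A := fun _ => δ) hf θ)).congr_deriv ?_)
  push_cast
  ring

theorem differentiable_gaugeFactor_mul_iff (hA : Continuous A) (δ : ℝ) :
    Differentiable ℝ (fun θ => gaugeFactor A δ θ * f θ) ↔ Differentiable ℝ f := by
  have hgauge : Differentiable ℝ (gaugeFactor A δ) :=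
    fun θ => (hasDerivAt_gaugeFactor hA δ θ).differentiableAt
  refine ⟨fun h => ?_, hgauge.mul⟩
  have hcancel : ((gaugeFactor A δ)⁻¹ * fun θ => gaugeFactor A δ θ * f θ) = f :=
    funext fun θ => inv_mul_cancel_left₀ (gaugeFactor_ne_zero A δ θ) (f θ)
  rw [← hcancel]
  exact (hgauge.inv (gaugeFactor_ne_zero A δ)).mul h

end GaugeFactor

/-- The potential as a continuous function on `ℝ / 2πℤ`. -/
def circlePotential (a : UnitCircle → ℝ) (ha : Continuous a) : C(Circ, ℂ) :=
  periodicLift (f := fun θ => (a (pt θ) : ℂ)) (fun θ => by simp only [pt_periodic θ])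
    (Complex.continuous_ofReal.comp (ha.comp lipschitzWith_pt.continuous))

section CirclePotential

variable {a : UnitCircle → ℝ} (ha : Continuous a)

theorem circlePotential_coe (θ : ℝ) : circlePotential a ha θ = (a (pt θ) : ℂ) := rfl

theorem star_circlePotential : star (circlePotential a ha) = circlePotential a ha :=
  circle_ext fun θ => Complex.conj_ofReal (a (pt θ))

theorem circleCoeff_zero_circlePotential : circleCoeff 0 (circlePotential a ha) = avga a := by
  rw [circleCoeff_eq_fourierCoeff, fourierCoeff_eq_intervalIntegral _ 0 0, zero_add,
    Complex.real_smul, avga, average, Complex.ofReal_mul, ← intervalIntegral.integral_ofReal]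
  simp only [neg_zero, fourier_zero, one_smul, circlePotential_coe]

theorem exists_abs_mul_norm_circleCoeff_circlePotential_le {L : NNReal} (hL : LipschitzWith L a) :
    ∃ B : ℝ, ∀ m : ℤ, |(m : ℝ)| * ‖circleCoeff m (circlePotential a hL.continuous)‖ ≤ B := by
  refine ⟨L * (2 * Real.pi) / 4, fun m => ?_⟩
  rw [circleCoeff_eq_fourierCoeff]
  refine abs_mul_norm_fourierCoeff_le_of_lipschitzWith
    (LipschitzWith.of_dist_le_mul fun s t => ?_) m
  rw [circlePotential_coe, circlePotential_coe, dist_eq_norm, ← Complex.ofReal_sub,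
    Complex.norm_real, ← dist_eq_norm]
  simpa using (hL.comp lipschitzWith_pt).dist_le_mul s t

end CirclePotential

section Eigenspace

variable {Avec : UnitCircle → Plane} {a : UnitCircle → ℝ} {δ t : ℝ} {ψ : UnitCircle → ℂ}

theorem solvesEigenEq_iff (hA : Continuous Avec) (ha : Continuous a) {f : ℝ → ℂ}
    (h : ∀ θ, ψ (pt θ) = gaugeFactor (angularComponent Avec) δ θ * f θ) :
    SolvesEigenEq Avec a t ψ ↔ IsCircleSolution δ (circlePotential a ha) t f := by
  have hA' := continuous_angularComponent hA
  unfold SolvesEigenEq IsCircleSolution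
  rw [funext h, differentiable_gaugeFactor_mul_iff hA']
  refine and_congr_right fun hf => ?_
  rw [magneticDeriv_gaugeFactor hA' δ hf, differentiable_gaugeFactor_mul_iff hA']
  refine and_congr_right fun hDf => forall_congr' fun θ => ?_
  rw [magneticDeriv_gaugeFactor hA' δ hDf, h, circlePotential_coe, mul_left_comm, ← mul_add,
    mul_left_comm, mul_right_inj' (gaugeFactor_ne_zero _ δ θ)]

theorem mem_eigenspaceL_iff (hA : Continuous Avec) (ha : Continuous a) {m : ℤ}
    (hm : avgA Avec = δ + m) (hδ : ∀ n : ℤ, δ ≠ n) :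
    ψ ∈ eigenspaceL Avec a t ↔ ∃ v : C(Circ, ℂ), IsFourierEigen δ (circlePotential a ha) t v ∧
      ∀ θ : ℝ, ψ (pt θ) = gaugeFactor (angularComponent Avec) δ θ * v θ := by
  constructor
  · intro (hψ : SolvesEigenEq Avec a t ψ)
    set f : ℝ → ℂ := fun θ => (gaugeFactor (angularComponent Avec) δ θ)⁻¹ * ψ (pt θ) with hf
    have hψf (θ : ℝ) : ψ (pt θ) = gaugeFactor (angularComponent Avec) δ θ * f θ :=
      (mul_inv_cancel_left₀ (gaugeFactor_ne_zero _ _ _) _).symm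
    have hsol := (solvesEigenEq_iff hA ha hψf).mp hψ
    have hper : Function.Periodic f (2 * Real.pi) := fun θ => by
      simp only [hf, pt_periodic θ, gaugeFactor_periodic (continuous_angularComponent hA)
        (periodic_angularComponent Avec) hm θ]
    exact ⟨periodicLift hper hsol.1.continuous, IsCircleSolution.isFourierEigen hsol, hψf⟩
  · rintro ⟨v, hv, hψ⟩
    exact (solvesEigenEq_iff hA ha hψ).mpr (hv.isCircleSolution hδ)

theorem exists_comp_pt_eq_gaugeFactor_mul (hA : Continuous Avec) {m : ℤ}
    (hm : avgA Avec = δ + m) (v : C(Circ, ℂ)) : ∃ ψ : UnitCircle → ℂ, ∀ θ : ℝ,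
      ψ (pt θ) = gaugeFactor (angularComponent Avec) δ θ * v θ :=
  exists_comp_pt_eq_of_periodic ((gaugeFactor_periodic (continuous_angularComponent hA)
    (periodic_angularComponent Avec) hm).mul (periodic_circle_coe v))

theorem integral_norm_sq_comp_pt {v : C(Circ, ℂ)}
    (h : ∀ θ : ℝ, ψ (pt θ) = gaugeFactor (angularComponent Avec) δ θ * v θ) :
    ∫ θ in (0 : ℝ)..(2 * Real.pi), ‖ψ (pt θ)‖ ^ 2 = 2 * Real.pi * ‖circleL2 v‖ ^ 2 := by
  have hpreimage :=
    AddCircle.intervalIntegral_preimage (2 * Real.pi) 0 (fun x : Circ => ‖v x‖ ^ 2)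
  rw [zero_add] at hpreimage
  simp only [h, norm_mul, norm_gaugeFactor, one_mul]
  rw [hpreimage, norm_sq_circleL2, AddCircle.integral_haarAddCircle, smul_eq_mul,
    mul_inv_cancel_left₀ Real.two_pi_pos.ne']

theorem eigenspaceL_eq_span (hA : Continuous Avec) (ha : Continuous a) {m : ℤ}
    (hm : avgA Avec = δ + m) (hδ : ∀ n : ℤ, 2 * δ ≠ n) (hδ' : ∀ n : ℤ, δ ≠ n) {v : C(Circ, ℂ)}
    (hv : IsFourierEigen δ (circlePotential a ha) t v) (hv0 : v ≠ 0)
    (hψ : ∀ θ : ℝ, ψ (pt θ) = gaugeFactor (angularComponent Avec) δ θ * v θ) :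
    eigenspaceL Avec a t = Submodule.span ℂ {ψ} := by
  ext φ
  rw [mem_eigenspaceL_iff hA ha hm hδ', Submodule.mem_span_singleton]
  constructor
  · rintro ⟨w, hw, hφ⟩
    obtain ⟨c, rfl⟩ :=
      (hv.isCircleSolution hδ').exists_eq_smul hδ (hw.isCircleSolution hδ') hv0
    refine ⟨c, pt_surjective.injective_comp_right (funext fun θ => ?_)⟩
    simp only [Function.comp_apply, Pi.smul_apply, hψ, hφ, ContinuousMap.smul_apply, smul_eq_mul]
    exact mul_left_comm _ _ _
  · rintro ⟨c, rfl⟩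
    refine ⟨c • v, hv.smul c, fun θ => ?_⟩
    simp only [Pi.smul_apply, hψ, ContinuousMap.smul_apply, smul_eq_mul]
    exact mul_left_comm _ _ _

theorem eigenspaceL_eq_bot (hA : Continuous Avec) (ha : Continuous a) {m : ℤ}
    (hm : avgA Avec = δ + m) (hδ : ∀ n : ℤ, δ ≠ n)
    (ht : t ∉ fourierSpectrum δ (circlePotential a ha)) : eigenspaceL Avec a t = ⊥ := by
  refine (Submodule.eq_bot_iff _).mpr fun φ hφ => ?_
  obtain ⟨w, hw, hφw⟩ := (mem_eigenspaceL_iff hA ha hm hδ).mp hφ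
  have hw0 : w = 0 := by_contra fun hne => ht ⟨w, hne, hw⟩
  refine pt_surjective.injective_comp_right (funext fun θ => ?_)
  exact (hφw θ).trans (by rw [hw0, ContinuousMap.zero_apply, mul_zero]; rfl)

theorem isEigenvalueSequence_of_range_eq (hA : Continuous Avec) (ha : Continuous a) {m : ℤ}
    (hm : avgA Avec = δ + m) (hδ : ∀ n : ℤ, 2 * δ ≠ n) {μ : ℕ → ℝ} (hμ : StrictMono μ)
    (hrange : Set.range μ = fourierSpectrum δ (circlePotential a ha))
    (htendsto : Tendsto μ atTop atTop) : IsEigenvalueSequence Avec a μ := by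
  have hδ' (n : ℤ) : δ ≠ n := fun h => hδ (2 * n) (by rw [h]; push_cast; rfl)
  have hmult (t : ℝ) : Module.Finite ℂ (eigenspaceL Avec a t) ∧
      {k : ℕ | μ k = t}.ncard = Module.finrank ℂ (eigenspaceL Avec a t) := by
    by_cases ht : t ∈ Set.range μ
    · obtain ⟨v, hv0, hv⟩ := hrange ▸ ht
      obtain ⟨ψ, hψ⟩ := exists_comp_pt_eq_gaugeFactor_mul hA hm v
      have hψ0 : ψ ≠ 0 := by
        rintro rfl
        exact hv0 (circle_ext fun θ =>
          (mul_eq_zero.mp (hψ θ).symm).resolve_left (gaugeFactor_ne_zero _ _ _))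
      obtain ⟨k, rfl⟩ := ht
      rw [eigenspaceL_eq_span hA ha hm hδ hδ' hv hv0 hψ, finrank_span_singleton hψ0]
      refine ⟨inferInstance, ?_⟩
      simp only [hμ.injective.eq_iff, Set.ofPred_eq_eq_singleton, Set.ncard_singleton]
    · rw [eigenspaceL_eq_bot hA ha hm hδ' (hrange ▸ ht), finrank_bot]
      have hempty : {k | μ k = t} = ∅ := Set.eq_empty_of_forall_notMem fun k hk => ht ⟨k, hk⟩
      exact ⟨inferInstance, by rw [hempty, Set.ncard_empty]⟩
  exact ⟨hμ.monotone, htendsto, fun t => (hmult t).1, fun t => (hmult t).2⟩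

end Eigenspace

theorem exists_strictMono_range_eq {S : Set ℝ} (hinf : S.Infinite)
    (hfin : ∀ T, (S ∩ Set.Iic T).Finite) :
    ∃ μ : ℕ → ℝ, StrictMono μ ∧ Set.range μ = S ∧ Tendsto μ atTop atTop := by
  have hlarge (T : ℝ) : ∃ s ∈ S, T < s := by
    by_contra! hle
    exact hinf ((hfin T).subset fun s hs => ⟨hs, hle s hs⟩)
  obtain ⟨s₀, hs₀, -⟩ := hlarge 0
  obtain ⟨b, hb, hbmin⟩ := Set.exists_min_image _ id (hfin s₀) ⟨s₀, hs₀, le_refl s₀⟩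
  have hbot (s : S) : b ≤ s :=
    (le_total (s : ℝ) s₀).elim (fun hs => hbmin s ⟨s.2, hs⟩) hb.2.trans
  let _ : LocallyFiniteOrder S := LocallyFiniteOrder.ofFiniteIcc fun x y => by
    refine Set.Finite.of_finite_image (f := Subtype.val) ((hfin y).subset ?_)
      Subtype.val_injective.injOn
    rintro _ ⟨z, hz, rfl⟩
    exact ⟨z.2, hz.2⟩
  let _ : SuccOrder S := LinearLocallyFiniteOrder.succOrder S
  let _ : PredOrder S := LinearLocallyFiniteOrder.predOrder S
  let _ : OrderBot S := { bot := ⟨b, hb.1⟩, bot_le := hbot }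
  have : NoMaxOrder S := ⟨fun s => by
    obtain ⟨t, ht, hst⟩ := hlarge s
    exact ⟨⟨t, ht⟩, hst⟩⟩
  let e : S ≃o ℕ := orderIsoNatOfLinearSuccPredArch
  have hmono : StrictMono fun n => (e.symm n : ℝ) := e.symm.strictMono
  refine ⟨fun n => (e.symm n : ℝ), hmono, ?_, ?_⟩
  · exact (e.symm.surjective.range_comp Subtype.val).trans Subtype.range_coe
  · refine tendsto_atTop_atTop_of_monotone hmono.monotone fun T => ?_
    obtain ⟨s, hs, hT⟩ := hlarge T
    exact ⟨e ⟨s, hs⟩, by simpa only [e.symm_apply_apply] using hT.le⟩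

theorem exists_le_iff_lt_of_tendsto_atTop {μ : ℕ → ℝ} (hμ : Monotone μ)
    (htendsto : Tendsto μ atTop atTop) (T : ℝ) : ∃ N, ∀ k, N ≤ k ↔ T < μ k := by
  classical
  have hex : ∃ k, T < μ k := (htendsto.eventually_gt_atTop T).exists
  exact ⟨Nat.find hex, fun k =>
    ⟨fun hk => (Nat.find_spec hex).trans_le (hμ hk), Nat.find_min' hex⟩⟩

theorem eventually_cofinite_iff_exists_forall_le_abs {p : ℤ → Prop} :
    (∀ᶠ j in cofinite, p j) ↔ ∃ ℓ : ℕ, ∀ j : ℤ, (ℓ : ℤ) ≤ |j| → p j := by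
  constructor
  · intro (hp : {j | ¬p j}.Finite)
    obtain ⟨b, hb⟩ := (hp.image Int.natAbs).bddAbove
    refine ⟨b + 1, fun j hj => by_contra fun hpj => ?_⟩
    have hle := hb (Set.mem_image_of_mem Int.natAbs hpj)
    rw [Int.abs_eq_natAbs] at hj
    omega
  · rintro ⟨ℓ, hℓ⟩
    refine (Set.finite_Icc (-(ℓ : ℤ)) ℓ).subset fun j hj => abs_le.mp ?_
    exact (lt_of_not_ge fun hle => hj (hℓ j hle)).le

theorem eventually_cofinite_le_abs (x : ℝ) : ∀ᶠ j : ℤ in cofinite, x ≤ |(j : ℝ)| := by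
  obtain ⟨ℓ, hℓ⟩ := exists_nat_ge x
  refine eventually_cofinite_iff_exists_forall_le_abs.mpr ⟨ℓ, fun j hj => hℓ.trans ?_⟩
  exact_mod_cast hj

section SqrtAsymptotics

theorem abs_sqrt_sub_mul_le {x ε : ℝ} (hx : 0 ≤ x) : |√(x ^ 2 + ε) - x| * x ≤ |ε| := by
  rcases le_total 0 (x ^ 2 + ε) with hpos | hneg
  · have hfactor : (√(x ^ 2 + ε) - x) * (√(x ^ 2 + ε) + x) = ε := by
      linear_combination Real.sq_sqrt hpos
    calc |√(x ^ 2 + ε) - x| * x ≤ |√(x ^ 2 + ε) - x| * |√(x ^ 2 + ε) + x| := by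
          gcongr
          exact (le_add_of_nonneg_left (Real.sqrt_nonneg _)).trans (le_abs_self _)
      _ = |ε| := by rw [← abs_mul, hfactor]
  · rw [Real.sqrt_eq_zero_of_nonpos hneg, zero_sub, abs_neg, abs_of_nonneg hx]
    linarith [neg_abs_le ε]

theorem sign_mul_add_abs_eq {δ : ℝ} (hδ : |δ| ≤ 1 / 2) {j : ℤ} (hj : j ≠ 0) :
    (Int.sign j : ℝ) * δ + |(j : ℝ)| = |(j : ℝ) + δ| := by
  obtain ⟨hlower, hupper⟩ := abs_le.mp hδ
  rcases lt_or_gt_of_ne hj with hneg | hpos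
  · have hj1 : (j : ℝ) ≤ -1 := by exact_mod_cast Int.le_sub_one_of_lt hneg
    rw [Int.sign_eq_neg_one_of_neg hneg, abs_of_neg (by linarith : (j : ℝ) < 0),
      abs_of_neg (by linarith : (j : ℝ) + δ < 0)]
    push_cast
    ring
  · have hj1 : (1 : ℝ) ≤ j := by exact_mod_cast hpos
    rw [Int.sign_eq_one_of_pos hpos, abs_of_pos (by linarith : (0 : ℝ) < j),
      abs_of_pos (by linarith : 0 < (j : ℝ) + δ)]
    push_cast
    ring

theorem abs_sqrt_sub_sign_mul_add_abs_le {δ c t C : ℝ} (hδ : |δ| ≤ 1 / 2) {j : ℤ} (hj : j ≠ 0)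
    (ht : |t - (c + ((j : ℝ) + δ) ^ 2)| ≤ C / |(j : ℝ)| ^ 2) :
    |√(t - c) - ((Int.sign j : ℝ) * δ + |(j : ℝ)|)| ≤ 2 * C / |(j : ℝ)| ^ 3 := by
  have hj1 : (1 : ℝ) ≤ |(j : ℝ)| := by exact_mod_cast Int.one_le_abs hj
  have hx : |(j : ℝ)| / 2 ≤ |(j : ℝ) + δ| := by
    have htriangle := abs_sub_abs_le_abs_sub (j : ℝ) (-δ)
    rw [abs_neg, sub_neg_eq_add] at htriangle
    linarith
  have hsplit : t - c = |(j : ℝ) + δ| ^ 2 + (t - (c + ((j : ℝ) + δ) ^ 2)) := by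
    rw [sq_abs]
    ring
  rw [sign_mul_add_abs_eq hδ hj, hsplit]
  have hbound := (mul_le_mul_of_nonneg_left hx (abs_nonneg _)).trans
    ((abs_sqrt_sub_mul_le (abs_nonneg ((j : ℝ) + δ))).trans ht)
  rw [le_div_iff₀ (by positivity)] at hbound ⊢
  linarith

end SqrtAsymptotics

section NormalizedMode

variable {j : ℤ} {h : C(Circ, ℂ)}

theorem norm_inv_norm_smul_sub_le (hj : circleCoeff j h = 0) (x : Circ) :
    ‖((‖circleL2 (fourier j + h)‖⁻¹ : ℝ) : ℂ) * (fourier j + h : C(Circ, ℂ)) x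
      - (fourier j : C(Circ, ℂ)) x‖ ≤ 2 * ‖h‖ := by
  have hlower := one_le_norm_circleL2_fourier_add hj
  have hupper : ‖circleL2 (fourier j + h)‖ ≤ 1 + ‖h‖ := by
    rw [map_add, ← norm_circleL2_fourier (T := 2 * Real.pi) j]
    exact (norm_add_le _ _).trans (by gcongr; exact norm_circleL2_le h)
  set n := ‖circleL2 (fourier j + h)‖
  have hinv : n⁻¹ ≤ 1 := inv_le_one_of_one_le₀ hlower
  have hn : |n⁻¹ - 1| ≤ ‖h‖ := by
    calc |n⁻¹ - 1| = n⁻¹ * (n - 1) := by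
          rw [abs_of_nonpos (by linarith), mul_sub, inv_mul_cancel₀ (by positivity)]
          ring
      _ ≤ 1 * ‖h‖ := by
          gcongr
          linarith
      _ = ‖h‖ := one_mul _
  calc ‖((n⁻¹ : ℝ) : ℂ) * (fourier j + h : C(Circ, ℂ)) x - (fourier j : C(Circ, ℂ)) x‖
      = ‖((n⁻¹ - 1 : ℝ) : ℂ) * (fourier j : C(Circ, ℂ)) x + ((n⁻¹ : ℝ) : ℂ) * h x‖ := by
        rw [ContinuousMap.add_apply]
        push_cast
        ring_nf
    _ ≤ |n⁻¹ - 1| * ‖(fourier j : C(Circ, ℂ)) x‖ + |n⁻¹| * ‖h x‖ := by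
        simpa only [norm_mul, Complex.norm_real, Real.norm_eq_abs] using norm_add_le
          (((n⁻¹ - 1 : ℝ) : ℂ) * (fourier j : C(Circ, ℂ)) x) (((n⁻¹ : ℝ) : ℂ) * h x)
    _ ≤ ‖h‖ * 1 + 1 * ‖h‖ := by
        gcongr
        · rw [fourier_apply, Circle.norm_coe]
        · rwa [abs_of_nonneg (by positivity)]
        · exact h.norm_coe_le_norm x
    _ = 2 * ‖h‖ := by ring

theorem two_pi_mul_norm_sq_circleL2_smul {v : C(Circ, ℂ)} (hv : v ≠ 0) :
    2 * Real.pi * ‖circleL2 (((1 / √(2 * Real.pi) * ‖circleL2 v‖⁻¹ : ℝ) : ℂ) • v)‖ ^ 2 = 1 := by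
  have hv0 : 0 < ‖circleL2 v‖ := norm_pos_iff.mpr (circleL2_ne_zero hv)
  rw [map_smul, norm_smul, Complex.norm_of_nonneg (by positivity),
    inv_mul_cancel_right₀ hv0.ne', div_pow, Real.sq_sqrt Real.two_pi_pos.le, one_pow,
    mul_one_div_cancel Real.two_pi_pos.ne']

end NormalizedMode

/-- The perturbed Fourier modes: for `|j| ≥ ℓ` the function `fourier j + h j` is an eigenfunction of
`(-i d/dθ + δ)² + q`, and its eigenvalue `lam j` is at distance at most `W` from `(j + δ)²`; the
remaining fields make `ℓ` large enough for these eigenvalues to be separated. -/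
structure IsPerturbedFamily (δ κ W : ℝ) (q : C(Circ, ℂ)) (ℓ : ℕ) (lam : ℤ → ℝ)
    (h : ℤ → C(Circ, ℂ)) : Prop where
  nonresonant : IsNonresonant δ κ
  norm_lt : ‖q‖ < W
  two_le : (2 : ℝ) ≤ ℓ
  separated : 2 * W + 2 * ‖q‖ < κ / 2 * ℓ
  eigen : ∀ j : ℤ, (ℓ : ℤ) ≤ |j| → IsFourierEigen δ q (lam j) (fourier j + h j)
  coeff : ∀ j : ℤ, (ℓ : ℤ) ≤ |j| → circleCoeff j (h j) = 0
  norm_le : ∀ j : ℤ, (ℓ : ℤ) ≤ |j| → ‖h j‖ ≤ 1 / 2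
  abs_sub_le : ∀ j : ℤ, (ℓ : ℤ) ≤ |j| → |lam j - ((j : ℝ) + δ) ^ 2| ≤ W

theorem exists_isPerturbedFamily {δ κ : ℝ} (hδ : IsNonresonant δ κ) {q : C(Circ, ℂ)}
    (hq : star q = q) {c B : ℝ} (hc : circleCoeff 0 q = c)
    (hB : ∀ m : ℤ, |(m : ℝ)| * ‖circleCoeff m q‖ ≤ B) :
    ∃ (C W : ℝ) (ℓ : ℕ) (lam : ℤ → ℝ) (h : ℤ → C(Circ, ℂ)), IsPerturbedFamily δ κ W q ℓ lam h ∧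
      ∀ j : ℤ, (ℓ : ℤ) ≤ |j| →
        |lam j - (c + ((j : ℝ) + δ) ^ 2)| ≤ C / |(j : ℝ)| ^ 2 ∧ ‖h j‖ ≤ C / |(j : ℝ)| := by
  obtain ⟨C, hpert⟩ := eventually_exists_isFourierEigen_fourier_add hδ hq hc hB
  set W : ℝ := ‖q‖ + |c| + 1
  have hκ := hδ.pos
  obtain ⟨ℓ, hℓ⟩ := eventually_cofinite_iff_exists_forall_le_abs.mp
    (((hpert.and (eventually_cofinite_le_abs 2)).and (eventually_cofinite_le_abs (2 * C))).and
      (eventually_cofinite_le_abs ((2 * W + 2 * ‖q‖ + 1) / (κ / 2))))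
  choose! ε h hh hε hcoeff heig using fun j hj => (hℓ j hj).1.1.1
  have htwo (j : ℤ) (hj : (ℓ : ℤ) ≤ |j|) : 2 ≤ |(j : ℝ)| := (hℓ j hj).1.1.2
  have hCj (j : ℤ) (hj : (ℓ : ℤ) ≤ |j|) : C ≤ 1 / 2 * |(j : ℝ)| := by linarith [(hℓ j hj).1.2]
  have habs : |((ℓ : ℤ) : ℝ)| = ℓ := by rw [Int.cast_natCast, Nat.abs_cast]
  have hsep := (hℓ ℓ (le_abs_self _)).2
  rw [div_le_iff₀' (by positivity), habs] at hsep
  refine ⟨C, W, ℓ, fun j => c + ((j : ℝ) + δ) ^ 2 + ε j, h,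
    { nonresonant := hδ
      norm_lt := by linarith [abs_nonneg c]
      two_le := habs ▸ htwo ℓ (le_abs_self _)
      separated := by linarith
      eigen := heig
      coeff := hcoeff
      norm_le := fun j hj => (hh j hj).trans ?_
      abs_sub_le := fun j hj => ?_ },
    fun j hj => ⟨by simpa only [add_sub_cancel_left] using hε j hj, hh j hj⟩⟩
  · rw [div_le_iff₀ (by linarith [htwo j hj])]
    exact hCj j hj
  · have hε1 : |ε j| ≤ 1 := (hε j hj).trans <| by
      rw [div_le_one (by nlinarith [htwo j hj])]
      nlinarith [htwo j hj, hCj j hj]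
    calc |c + ((j : ℝ) + δ) ^ 2 + ε j - ((j : ℝ) + δ) ^ 2| = |c + ε j| := by ring_nf
      _ ≤ |c| + |ε j| := abs_add_le _ _
      _ ≤ W := by linarith [norm_nonneg q]

namespace IsPerturbedFamily

variable {δ κ W t : ℝ} {q : C(Circ, ℂ)} {ℓ : ℕ} {lam : ℤ → ℝ} {h : ℤ → C(Circ, ℂ)}
  (H : IsPerturbedFamily δ κ W q ℓ lam h)

include H

theorem index_ne_zero {j : ℤ} (hj : (ℓ : ℤ) ≤ |j|) : j ≠ 0 := by
  rintro rfl
  have hle : (ℓ : ℝ) ≤ 0 := by exact_mod_cast hj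
  linarith [H.two_le]

theorem separated_of_le_abs {j : ℤ} (hj : (ℓ : ℤ) ≤ |j|) :
    2 * W + 2 * ‖q‖ < κ / 2 * |(j : ℝ)| :=
  H.separated.trans_le <|
    mul_le_mul_of_nonneg_left (by exact_mod_cast hj) (half_pos H.nonresonant.pos).le

theorem eq_of_abs_sub_le (hq : star q = q) (ht : t ∈ fourierSpectrum δ q) {j : ℤ}
    (hj : (ℓ : ℤ) ≤ |j|) (htj : |t - ((j : ℝ) + δ) ^ 2| ≤ W) : t = lam j := by
  obtain ⟨v, hv0, hv⟩ := ht
  have hW := H.norm_lt.trans_le' (norm_nonneg q)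
  by_contra hne
  refine hv.inner_fourier_add_ne_zero H.nonresonant (H.index_ne_zero hj) hv0 (W := W) ?_
    (by linarith [H.separated_of_le_abs hj]) (H.norm_le j hj)
    ((H.eigen j hj).inner_eq_zero hq (Ne.symm hne) hv)
  rwa [← Complex.ofReal_sub, Complex.norm_real, Real.norm_eq_abs]

theorem injOn : Set.InjOn lam {j | (ℓ : ℤ) ≤ |j|} := by
  intro j hj n hn hjn
  by_contra hne
  have hgap := H.nonresonant.gap (H.index_ne_zero hj) (Ne.symm hne)
  have hclose : |((j : ℝ) + δ) ^ 2 - ((n : ℝ) + δ) ^ 2| ≤ W + W := by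
    refine (_root_.abs_sub_le _ (lam j) _).trans (add_le_add ?_ (hjn ▸ H.abs_sub_le n hn))
    exact abs_sub_comm (lam j) _ ▸ H.abs_sub_le j hj
  linarith [H.separated_of_le_abs hj, norm_nonneg q]

/-- `(ℓ - 1/2)²` lies halfway between the perturbed eigenvalues with `|j| < ℓ` and `|j| ≥ ℓ`. -/
theorem fourierSpectrum_inter_Ioi (hq : star q = q) :
    fourierSpectrum δ q ∩ Set.Ioi (((ℓ : ℝ) - 1 / 2) ^ 2) = lam '' {j | (ℓ : ℤ) ≤ |j|} := by
  have hδ0 := abs_nonneg δ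
  have hδ : |δ| ≤ 1 / 2 := H.nonresonant.abs_le
  have hℓ := H.two_le
  have hW : W < (1 / 2 - |δ|) * ℓ := by
    have hκ : κ / 2 * ℓ ≤ (1 / 2 - |δ|) * ℓ := by
      gcongr
      linarith [H.nonresonant.le_one_sub]
    linarith [H.separated, H.norm_lt, norm_nonneg q]
  ext t
  constructor
  · rintro ⟨ht, htT⟩
    obtain ⟨n, hn⟩ := exists_abs_sub_lt_of_mem_fourierSpectrum ht H.norm_lt
    suffices hnℓ : (ℓ : ℤ) ≤ |n| from ⟨n, hnℓ, (H.eq_of_abs_sub_le hq ht hnℓ hn.le).symm⟩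
    by_contra! hlt
    have hnℓ : |(n : ℝ)| + 1 ≤ ℓ := by exact_mod_cast hlt
    have hsq : ((n : ℝ) + δ) ^ 2 ≤ (ℓ - 1 + |δ|) ^ 2 :=
      sq_le_sq' (by linarith [neg_abs_le (n : ℝ), neg_abs_le δ])
        (by linarith [le_abs_self (n : ℝ), le_abs_self δ])
    have htT' : ((ℓ : ℝ) - 1 / 2) ^ 2 < t := htT
    nlinarith [(abs_lt.mp hn).2, mul_nonneg (sub_nonneg.mpr hδ) (by linarith : 0 ≤ ℓ - 3 / 2 + |δ|)]
  · rintro ⟨j, hj, rfl⟩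
    refine ⟨⟨_, fourier_add_ne_zero (H.coeff j hj), H.eigen j hj⟩, ?_⟩
    have hjℓ : (ℓ : ℝ) ≤ |(j : ℝ)| := by exact_mod_cast hj
    have htriangle := abs_sub_abs_le_abs_sub (j : ℝ) (-δ)
    rw [abs_neg, sub_neg_eq_add] at htriangle
    have hsq : (ℓ - |δ|) ^ 2 ≤ ((j : ℝ) + δ) ^ 2 :=
      sq_le_sq.mpr (by rw [abs_of_nonneg] <;> linarith)
    change ((ℓ : ℝ) - 1 / 2) ^ 2 < lam j
    nlinarith [(abs_le.mp (H.abs_sub_le j hj)).1,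
      mul_nonneg (sub_nonneg.mpr hδ) (by linarith : 0 ≤ ℓ - 1 / 2 - |δ|)]

theorem fourierSpectrum_infinite : (fourierSpectrum δ q).Infinite := by
  have hindex : {j : ℤ | (ℓ : ℤ) ≤ |j|}.Infinite :=
    (Set.Ici_infinite (ℓ : ℤ)).mono fun j hj => le_trans hj (le_abs_self j)
  refine (hindex.image H.injOn).mono ?_
  rintro _ ⟨j, hj, rfl⟩
  exact ⟨_, fourier_add_ne_zero (H.coeff j hj), H.eigen j hj⟩

end IsPerturbedFamily

theorem exp_I_mul_add_int_mul (α : ℝ) (j : ℤ) (θ : ℝ) :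
    Complex.exp (Complex.I * (((α + j) * θ : ℝ) : ℂ))
      = Complex.exp (Complex.I * ((α * θ : ℝ) : ℂ)) * (fourier j : C(Circ, ℂ)) (θ : Circ) := by
  rw [fourier_coe_apply, ← Complex.exp_add]
  congr 1
  push_cast
  field_simp

theorem gaugeFactor_eq_exp_mul_exp (A : ℝ → ℝ) {α δ m : ℝ} (hα : α = δ + m) (θ : ℝ) :
    gaugeFactor A δ θ
      = Complex.exp (-Complex.I * ((m * θ + ∫ t in (0 : ℝ)..θ, A t : ℝ) : ℂ))
        * Complex.exp (Complex.I * ((α * θ : ℝ) : ℂ)) := by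
  rw [gaugeFactor, hα, ← Complex.exp_add]
  congr 1
  push_cast
  ring

/-- The remainder `R_j` of the eigenfunction with normalized Fourier side `fourier j + h`, relative
to the mode `e^{i(α + j)θ}`. -/
def modeRemainder (α : ℝ) (j : ℤ) (h : C(Circ, ℂ)) (θ : ℝ) : ℂ :=
  Complex.exp (Complex.I * ((α * θ : ℝ) : ℂ)) *
    (((‖circleL2 (fourier j + h)‖⁻¹ : ℝ) : ℂ) * (fourier j + h : C(Circ, ℂ)) θ
      - (fourier j : C(Circ, ℂ)) (θ : Circ))

theorem norm_modeRemainder_le {j : ℤ} {h : C(Circ, ℂ)} (hj : circleCoeff j h = 0) (α θ : ℝ) :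
    ‖modeRemainder α j h θ‖ ≤ 2 * ‖h‖ := by
  rw [modeRemainder, norm_mul, mul_comm Complex.I, Complex.norm_exp_ofReal_mul_I, one_mul]
  exact norm_inv_norm_smul_sub_le hj θ

theorem gaugeFactor_mul_eq_exp_mul_exp_add_modeRemainder (A : ℝ → ℝ) {α δ m : ℝ} (hα : α = δ + m)
    (s : ℝ) (j : ℤ) (h : C(Circ, ℂ)) (θ : ℝ) :
    gaugeFactor A δ θ
        * ((((s * ‖circleL2 (fourier j + h)‖⁻¹ : ℝ) : ℂ) • (fourier j + h) : C(Circ, ℂ)) θ)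
      = (s : ℂ) * Complex.exp (-Complex.I * ((m * θ + ∫ t in (0 : ℝ)..θ, A t : ℝ) : ℂ))
        * (Complex.exp (Complex.I * (((α + j) * θ : ℝ) : ℂ)) + modeRemainder α j h θ) := by
  rw [gaugeFactor_eq_exp_mul_exp A hα, exp_I_mul_add_int_mul, modeRemainder,
    ContinuousMap.smul_apply, smul_eq_mul, Complex.ofReal_mul s]
  ring

section HighSpectrum

variable {Avec : UnitCircle → Plane} {a : UnitCircle → ℝ} {δ κ : ℝ}

theorem IsFourierEigen.isNormalizedEigenfunction (hA : Continuous Avec) (ha : Continuous a) {m : ℤ}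
    (hm : avgA Avec = δ + m) (hδ : ∀ n : ℤ, δ ≠ n) {t : ℝ} {v : C(Circ, ℂ)}
    (hv : IsFourierEigen δ (circlePotential a ha) t v) (hnorm : 2 * Real.pi * ‖circleL2 v‖ ^ 2 = 1)
    {ψ : UnitCircle → ℂ}
    (hψ : ∀ θ : ℝ, ψ (pt θ) = gaugeFactor (angularComponent Avec) δ θ * v θ) :
    IsNormalizedEigenfunction Avec a t ψ :=
  ⟨(mem_eigenspaceL_iff hA ha hm hδ).mpr ⟨v, hv, hψ⟩, (integral_norm_sq_comp_pt hψ).trans hnorm⟩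

theorem IsPerturbedFamily.exists_isHighSpectrum {W C : ℝ} {ℓ : ℕ} {lam : ℤ → ℝ} {h : ℤ → C(Circ, ℂ)}
    {ha : Continuous a} (H : IsPerturbedFamily δ κ W (circlePotential a ha) ℓ lam h)
    (hA : Continuous Avec) (hδ : avgA Avec - ⌊avgA Avec + 1 / 2⌋ = δ)
    (hasymp : ∀ j : ℤ, (ℓ : ℤ) ≤ |j| →
      |lam j - (avga a + ((j : ℝ) + δ) ^ 2)| ≤ C / |(j : ℝ)| ^ 2 ∧ ‖h j‖ ≤ C / |(j : ℝ)|)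
    {μ : ℕ → ℝ} (hμ : StrictMono μ) (htendsto : Tendsto μ atTop atTop)
    (hrange : Set.range μ = fourierSpectrum δ (circlePotential a ha)) :
    ∃ (kstar : ℕ) (φ : ℤ → UnitCircle → ℂ) (R : ℤ → ℝ → ℂ),
      IsHighSpectrum Avec a μ kstar ℓ lam φ R := by
  have hm : avgA Avec = δ + ⌊avgA Avec + 1 / 2⌋ := by rw [← hδ, sub_add_cancel]
  have hδ_ne (n : ℤ) : δ ≠ n := fun h =>
    H.nonresonant.two_mul_ne (2 * n) (by rw [h]; push_cast; rfl)
  have hlarge : ∀ᶠ j : ℤ in cofinite, (ℓ : ℤ) ≤ |j| :=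
    eventually_cofinite_iff_exists_forall_le_abs.mpr ⟨ℓ, fun _ hj => hj⟩
  obtain ⟨kstar, hkstar⟩ :=
    exists_le_iff_lt_of_tendsto_atTop hμ.monotone htendsto (((ℓ : ℝ) - 1 / 2) ^ 2)
  choose φ hφ using fun j => exists_comp_pt_eq_gaugeFactor_mul hA hm
    (((1 / √(2 * Real.pi) * ‖circleL2 (fourier j + h j)‖⁻¹ : ℝ) : ℂ) • (fourier j + h j))
  refine ⟨kstar, φ, fun j => modeRemainder (avgA Avec) j (h j),
    { image_eq := ?_
      injOn_mu := hμ.injective.injOn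
      injOn_lam := H.injOn
      sqrt_asymp := ?_
      asymp := ?_
      eigen := fun j hj => ((H.eigen j hj).smul _).isNormalizedEigenfunction hA ha hm hδ_ne
        (two_pi_mul_norm_sq_circleL2_smul (fourier_add_ne_zero (H.coeff j hj))) (hφ j)
      eigen_eq := fun j _ θ => (hφ j θ).trans
        (gaugeFactor_mul_eq_exp_mul_exp_add_modeRemainder _ hm _ j (h j) θ)
      remainder := ⟨2 * C, ?_⟩ }⟩
  · simp only [hkstar]
    rw [← H.fourierSpectrum_inter_Ioi (star_circlePotential ha), ← hrange, Set.inter_comm,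
      ← Set.image_preimage_eq_inter_range]
    rfl
  · refine IsBigO.of_bound (2 * C) (hlarge.mono fun j hj => ?_)
    rw [hδ, Real.norm_eq_abs, Real.norm_of_nonneg (by positivity), mul_one_div]
    exact abs_sqrt_sub_sign_mul_add_abs_le H.nonresonant.abs_le (H.index_ne_zero hj) (hasymp j hj).1
  · refine IsBigO.of_bound C (hlarge.mono fun j hj => ?_)
    rw [add_sub_assoc, hδ, Real.norm_eq_abs, Real.norm_of_nonneg (by positivity), mul_one_div,
      ← sq_abs (j : ℝ)]
    exact (hasymp j hj).1
  · filter_upwards [hlarge] with j hj θ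
    rw [mul_div_assoc]
    exact (norm_modeRemainder_le (H.coeff j hj) _ θ).trans
      (mul_le_mul_of_nonneg_left (hasymp j hj).2 zero_le_two)

theorem exists_isHighSpectrum (hA : Continuous Avec) (ha : Continuous a)
    (hdecay : ∃ B : ℝ, ∀ m : ℤ, |(m : ℝ)| * ‖circleCoeff m (circlePotential a ha)‖ ≤ B)
    (hδ : avgA Avec - ⌊avgA Avec + 1 / 2⌋ = δ) (hres : IsNonresonant δ κ) :
    ∃ μ : ℕ → ℝ, IsEigenvalueSequence Avec a μ ∧
      ∃ (kstar ℓ : ℕ) (lam : ℤ → ℝ) (φ : ℤ → UnitCircle → ℂ) (R : ℤ → ℝ → ℂ),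
        IsHighSpectrum Avec a μ kstar ℓ lam φ R := by
  have hm : avgA Avec = δ + ⌊avgA Avec + 1 / 2⌋ := by rw [← hδ, sub_add_cancel]
  obtain ⟨B, hB⟩ := hdecay
  have hq := star_circlePotential ha
  obtain ⟨C, W, ℓ, lam, h, H, hasymp⟩ :=
    exists_isPerturbedFamily hres hq (circleCoeff_zero_circlePotential ha) hB
  obtain ⟨μ, hμ, hrange, htendsto⟩ :=
    exists_strictMono_range_eq H.fourierSpectrum_infinite (fourierSpectrum_inter_Iic_finite hq)
  obtain ⟨kstar, φ, R, hhigh⟩ := H.exists_isHighSpectrum hA hδ hasymp hμ htendsto hrange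
  exact ⟨μ, isEigenvalueSequence_of_range_eq hA ha hm hres.two_mul_ne hμ hrange htendsto,
    kstar, ℓ, lam, φ, R, hhigh⟩

end HighSpectrum

section Bessel

theorem besselJ_zero_right {ν : ℝ} (hν : 0 < ν) : besselJ ν 0 = 0 := by
  rw [besselJ, zero_div, Real.zero_rpow hν.ne', zero_mul]

theorem Gamma_add_one_le_Gamma_nat_add {ν : ℝ} (hν : 1 ≤ ν) (k : ℕ) :
    Real.Gamma (ν + 1) ≤ Real.Gamma (k + ν + 1) := by
  have hle : ν + 1 ≤ k + ν + 1 := by linarith [k.cast_nonneg (α := ℝ)]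
  exact Real.Gamma_strictMonoOn_Ici.monotoneOn (Set.mem_Ici.mpr (by linarith))
    (Set.mem_Ici.mpr (by linarith)) hle

theorem abs_besselJ_le {ν t : ℝ} (hν : 1 ≤ ν) (ht : 0 ≤ t) :
    |besselJ ν t| ≤ (t / 2) ^ ν / Real.Gamma (ν + 1) * Real.exp ((t / 2) ^ 2) := by
  have hx : 0 ≤ t / 2 := by positivity
  set x := t / 2
  have hΓ : 0 < Real.Gamma (ν + 1) := Real.Gamma_pos_of_pos (by linarith)
  have hmajorant : HasSum (fun k : ℕ => (Real.Gamma (ν + 1))⁻¹ * ((x ^ 2) ^ k / k.factorial))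
      ((Real.Gamma (ν + 1))⁻¹ * Real.exp (x ^ 2)) := by
    rw [Real.exp_eq_exp_ℝ]
    exact (NormedSpace.expSeries_div_hasSum_exp (x ^ 2)).mul_left _
  have hseries : ‖∑' k : ℕ, (-1 : ℝ) ^ k / (Real.Gamma (k + 1) * Real.Gamma (k + ν + 1))
      * x ^ (2 * k)‖ ≤ (Real.Gamma (ν + 1))⁻¹ * Real.exp (x ^ 2) := by
    refine tsum_of_norm_bounded hmajorant fun k => ?_
    have hΓk := Gamma_add_one_le_Gamma_nat_add hν k
    have hfact : (0 : ℝ) < k.factorial := by exact_mod_cast k.factorial_pos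
    rw [Real.Gamma_nat_eq_factorial, norm_mul, norm_div, norm_pow, norm_neg, norm_one, one_pow,
      Real.norm_of_nonneg (mul_nonneg hfact.le (hΓ.le.trans hΓk)),
      Real.norm_of_nonneg (pow_nonneg hx _), pow_mul]
    calc 1 / ((k.factorial : ℝ) * Real.Gamma (k + ν + 1)) * (x ^ 2) ^ k
        ≤ 1 / ((k.factorial : ℝ) * Real.Gamma (ν + 1)) * (x ^ 2) ^ k := by gcongr
      _ = _ := by field_simp
  calc |besselJ ν t| ≤ x ^ ν * ((Real.Gamma (ν + 1))⁻¹ * Real.exp (x ^ 2)) := by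
        rw [besselJ, abs_mul, abs_of_nonneg (Real.rpow_nonneg hx ν)]
        exact mul_le_mul_of_nonneg_left hseries (Real.rpow_nonneg hx ν)
    _ = x ^ ν / Real.Gamma (ν + 1) * Real.exp (x ^ 2) := by rw [← mul_assoc, div_eq_mul_inv]

theorem rpow_div_Gamma_le {ν x : ℝ} (hν : 1 ≤ ν) (hx : 0 ≤ x) :
    x ^ ν / Real.Gamma (ν + 1) ≤ (x + 1) * Real.exp (4 * (x + 1)) * (1 / 4) ^ ⌊ν⌋₊ := by
  set n := ⌊ν⌋₊
  have hn : (n : ℝ) ≤ ν := Nat.floor_le (by linarith)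
  have hn1 : (1 : ℝ) ≤ n := by exact_mod_cast Nat.le_floor (by simpa using hν)
  have hΓ : (n.factorial : ℝ) ≤ Real.Gamma (ν + 1) := by
    rw [← Real.Gamma_nat_eq_factorial]
    exact Real.Gamma_strictMonoOn_Ici.monotoneOn (Set.mem_Ici.mpr (by linarith))
      (Set.mem_Ici.mpr (by linarith)) (by linarith)
  have hpow : x ^ ν ≤ (x + 1) ^ (n + 1) :=
    calc x ^ ν ≤ (x + 1) ^ ν := Real.rpow_le_rpow hx (by linarith) (by linarith)
      _ ≤ (x + 1) ^ ((n + 1 : ℕ) : ℝ) := Real.rpow_le_rpow_of_exponent_le (by linarith)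
          (by exact_mod_cast (Nat.lt_floor_add_one ν).le)
      _ = (x + 1) ^ (n + 1) := Real.rpow_natCast _ _
  have hexp := Real.pow_div_factorial_le_exp (x := 4 * (x + 1)) (by positivity) n
  calc x ^ ν / Real.Gamma (ν + 1) ≤ (x + 1) ^ (n + 1) / n.factorial := by gcongr
    _ = (x + 1) * ((4 * (x + 1)) ^ n / n.factorial) * (1 / 4) ^ n := by
      rw [mul_pow, pow_succ, div_pow, one_pow]
      field_simp
    _ ≤ _ := by gcongr

theorem quarter_pow_floor_le {ν : ℝ} {n : ℕ} (hν : (n : ℝ) / 2 ≤ ν) :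
    (1 / 4 : ℝ) ^ ⌊ν⌋₊ ≤ 4 * (1 / 2) ^ n := by
  have hn : n ≤ 2 * (⌊ν⌋₊ + 1) := by
    have hfloor := Nat.lt_floor_add_one ν
    have hle : (n : ℝ) ≤ 2 * (⌊ν⌋₊ + 1) := by linarith
    exact_mod_cast hle
  calc (1 / 4 : ℝ) ^ ⌊ν⌋₊ = 4 * (1 / 2) ^ (2 * (⌊ν⌋₊ + 1)) := by
        rw [pow_mul, pow_succ]
        ring
    _ ≤ 4 * (1 / 2) ^ n := by
        gcongr ?_ * ?_
        exact pow_le_pow_of_le_one (by norm_num) (by norm_num) hn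

theorem norm_I_cpow_ofReal (β : ℝ) : ‖Complex.I ^ (β : ℂ)‖ = 1 := by
  rw [Complex.norm_cpow_of_ne_zero Complex.I_ne_zero]
  simp

theorem norm_radialFactor (s t : ℝ) : ‖radialFactor s t‖ = |besselJ (√s) t| := by
  rw [radialFactor, norm_mul, betaExp, alphaExp, neg_neg, ← Complex.ofReal_neg,
    norm_I_cpow_ofReal, one_mul, Complex.norm_real, Real.norm_eq_abs]

theorem radialFactor_zero_right {s : ℝ} (hs : 0 < s) : radialFactor s 0 = 0 := by
  rw [radialFactor, alphaExp, neg_neg, besselJ_zero_right (Real.sqrt_pos.mpr hs),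
    Complex.ofReal_zero, mul_zero]

theorem summable_half_pow_natAbs : Summable fun j : ℤ => (1 / 2 : ℝ) ^ j.natAbs :=
  .of_nat_of_neg (by simpa only [Int.natAbs_natCast] using summable_geometric_two)
    (by simpa only [Int.natAbs_neg, Int.natAbs_natCast] using summable_geometric_two)

theorem exists_norm_radialFactor_le {lam : ℤ → ℝ}
    (hlam : ∀ᶠ j : ℤ in cofinite, ((j : ℝ) / 2) ^ 2 ≤ lam j) {t : ℝ} (ht : 0 ≤ t) :
    ∃ D : ℝ, ∀ᶠ j : ℤ in cofinite, ‖radialFactor (lam j) t‖ ≤ D * (1 / 2) ^ j.natAbs := by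
  refine ⟨(t / 2 + 1) * Real.exp (4 * (t / 2 + 1)) * 4 * Real.exp ((t / 2) ^ 2), ?_⟩
  filter_upwards [hlam, eventually_cofinite_le_abs 2] with j hj htwo
  set ν := √(lam j)
  have hνj : |(j : ℝ)| / 2 ≤ ν := by
    rw [← abs_two, ← abs_div]
    exact Real.abs_le_sqrt hj
  have hν : 1 ≤ ν := by linarith
  have hpow : (1 / 4 : ℝ) ^ ⌊ν⌋₊ ≤ 4 * (1 / 2) ^ j.natAbs :=
    quarter_pow_floor_le (by rwa [Nat.cast_natAbs, Int.cast_abs])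
  calc ‖radialFactor (lam j) t‖
      ≤ (t / 2) ^ ν / Real.Gamma (ν + 1) * Real.exp ((t / 2) ^ 2) := by
        rw [norm_radialFactor]
        exact abs_besselJ_le hν ht
    _ ≤ ((t / 2 + 1) * Real.exp (4 * (t / 2 + 1)) * (4 * (1 / 2) ^ j.natAbs))
        * Real.exp ((t / 2) ^ 2) := by
        gcongr
        exact (rpow_div_Gamma_le hν (by positivity)).trans (by gcongr)
    _ = _ := by ring

end Bessel

section PolarCoordinates

theorem norm_smul_pt {r : ℝ} (hr : 0 ≤ r) (θ : ℝ) : ‖r • (pt θ : Plane)‖ = r := by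
  rw [norm_smul, norm_eq_of_mem_sphere, mul_one, Real.norm_of_nonneg hr]

theorem direction_smul_pt {r : ℝ} (hr : 0 < r) (θ : ℝ) : direction (r • (pt θ : Plane)) = pt θ := by
  have hne : r • (pt θ : Plane) ≠ 0 := norm_pos_iff.mp ((norm_smul_pt hr.le θ).symm ▸ hr)
  refine Subtype.ext ?_
  rw [direction, dif_neg hne]
  change ‖r • (pt θ : Plane)‖⁻¹ • r • (pt θ : Plane) = pt θ
  rw [norm_smul_pt hr.le, inv_smul_smul₀ hr.ne']

theorem kernelTerm_smul_pt {μ : ℕ → ℝ} (ψ : ℕ → UnitCircle → ℂ) {r r' : ℝ} (hr : 0 ≤ r)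
    (hr' : 0 ≤ r') (θ θ' : ℝ) {k : ℕ} (hk : 0 < μ k) :
    kernelTerm μ ψ (r • (pt θ : Plane)) (r' • (pt θ' : Plane)) k
      = radialFactor (μ k) (r * r') * ψ k (pt θ) * conj (ψ k (pt θ')) := by
  rw [kernelTerm, norm_smul_pt hr, norm_smul_pt hr']
  rcases hr.eq_or_lt with rfl | hpos
  · simp only [zero_mul, radialFactor_zero_right hk]
  rcases hr'.eq_or_lt with rfl | hpos'
  · simp only [mul_zero, radialFactor_zero_right hk, zero_mul]
  rw [direction_smul_pt hpos, direction_smul_pt hpos']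

end PolarCoordinates

theorem conj_exp_I_mul_ofReal (y : ℝ) :
    conj (Complex.exp (Complex.I * (y : ℂ))) = Complex.exp (-Complex.I * (y : ℂ)) := by
  rw [← Complex.exp_conj, map_mul, Complex.conj_I, Complex.conj_ofReal]

theorem highTerm_eq (Avec : UnitCircle → Plane) (lam : ℤ → ℝ) (R : ℤ → ℝ → ℂ)
    (r r' θ θ' : ℝ) (j : ℤ) :
    highTerm Avec lam R r r' θ θ' j = radialFactor (lam j) (r * r')
      * (Complex.exp (Complex.I * (((avgA Avec + j) * θ : ℝ) : ℂ)) + R j θ)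
      * conj (Complex.exp (Complex.I * (((avgA Avec + j) * θ' : ℝ) : ℂ)) + R j θ') := by
  rw [highTerm, map_add, conj_exp_I_mul_ofReal]

theorem exp_mul_conj_exp_eq (m : ℝ) (u u' θ θ' : ℝ) :
    Complex.exp (-Complex.I * ((m * θ + u : ℝ) : ℂ))
        * conj (Complex.exp (-Complex.I * ((m * θ' + u' : ℝ) : ℂ)))
      = Complex.exp (-Complex.I * ((u - u' : ℝ) : ℂ))
        * Complex.exp (-Complex.I * ((m * (θ - θ') : ℝ) : ℂ)) := by
  rw [← Complex.exp_conj, ← Complex.exp_add, ← Complex.exp_add, map_mul, map_neg, Complex.conj_I,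
    Complex.conj_ofReal]
  congr 1
  push_cast
  ring

namespace IsHighSpectrum

variable {Avec : UnitCircle → Plane} {a : UnitCircle → ℝ} {μ : ℕ → ℝ} {kstar ℓ : ℕ} {lam : ℤ → ℝ}
  {φ : ℤ → UnitCircle → ℂ} {R : ℤ → ℝ → ℂ}

theorem eventually_sq_le (H : IsHighSpectrum Avec a μ kstar ℓ lam φ R) :
    ∀ᶠ j : ℤ in cofinite, ((j : ℝ) / 2) ^ 2 ≤ lam j := by
  obtain ⟨C, hC⟩ := H.asymp.bound
  set δ : ℝ := avgA Avec - ⌊avgA Avec + 1 / 2⌋ with hδ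
  filter_upwards [hC, eventually_cofinite_le_abs (4 * |δ| + 4 * |C| + 4 * |avga a| + 4)]
    with j hj hlarge
  have hδ0 := abs_nonneg δ
  have hC0 := abs_nonneg C
  have ha0 := abs_nonneg (avga a)
  have hone : 1 ≤ |(j : ℝ)| := by linarith
  have herror : |lam j - (avga a + ((j : ℝ) + δ) ^ 2)| ≤ |C| := by
    rw [hδ, ← add_sub_assoc, ← Real.norm_eq_abs]
    refine (hj.trans (mul_le_mul_of_nonneg_right (le_abs_self C) (norm_nonneg _))).trans ?_
    refine mul_le_of_le_one_right hC0 ?_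
    rw [Real.norm_of_nonneg (by positivity), ← sq_abs]
    exact div_le_one_of_le₀ (one_le_pow₀ hone) (sq_nonneg _)
  have hshift : (|(j : ℝ)| - |δ|) ^ 2 ≤ ((j : ℝ) + δ) ^ 2 := by
    have hsub := abs_sub_abs_le_abs_sub (j : ℝ) (-δ)
    rw [abs_neg, sub_neg_eq_add] at hsub
    rw [← sq_abs ((j : ℝ) + δ)]
    exact pow_le_pow_left₀ (by linarith) hsub 2
  have hlower := (abs_le.mp herror).1
  have havga := neg_abs_le (avga a)
  rw [div_pow, ← sq_abs]
  nlinarith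

theorem exists_eventually_norm_exp_add_le (H : IsHighSpectrum Avec a μ kstar ℓ lam φ R) :
    ∃ C : ℝ, ∀ᶠ j : ℤ in cofinite, ∀ θ : ℝ,
      ‖Complex.exp (Complex.I * (((avgA Avec + j) * θ : ℝ) : ℂ)) + R j θ‖ ≤ C := by
  obtain ⟨C, hC⟩ := H.remainder
  refine ⟨1 + |C|, ?_⟩
  filter_upwards [hC, eventually_cofinite_le_abs 1] with j hj hone θ
  have hR : ‖R j θ‖ ≤ |C| :=
    calc ‖R j θ‖ ≤ C / |(j : ℝ)| := hj θ
      _ ≤ |C| / |(j : ℝ)| := by gcongr; exact le_abs_self C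
      _ ≤ |C| := div_le_self (abs_nonneg C) hone
  refine (norm_add_le _ _).trans (add_le_add (le_of_eq ?_) hR)
  rw [mul_comm, Complex.norm_exp_ofReal_mul_I]

theorem summable_highTerm (H : IsHighSpectrum Avec a μ kstar ℓ lam φ R) {r r' : ℝ} (hr : 0 ≤ r)
    (hr' : 0 ≤ r') (θ θ' : ℝ) : Summable (highTerm Avec lam R r r' θ θ') := by
  obtain ⟨D, hD⟩ := exists_norm_radialFactor_le H.eventually_sq_le (mul_nonneg hr hr')
  obtain ⟨C, hC⟩ := H.exists_eventually_norm_exp_add_le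
  refine Summable.of_norm_bounded_eventually (summable_half_pow_natAbs.mul_left (D * C * C)) ?_
  filter_upwards [hD, hC] with j hradial hmode
  have hD0 := (norm_nonneg _).trans hradial
  have hC0 := (norm_nonneg _).trans (hmode θ)
  rw [highTerm_eq, norm_mul, norm_mul, RCLike.norm_conj]
  calc _ ≤ D * (1 / 2) ^ j.natAbs * C * C :=
        mul_le_mul (mul_le_mul hradial (hmode θ) (norm_nonneg _) hD0) (hmode θ') (norm_nonneg _)
          (mul_nonneg hD0 hC0)
    _ = D * C * C * (1 / 2) ^ j.natAbs := by ring

theorem radialFactor_mul_conj_eq (H : IsHighSpectrum Avec a μ kstar ℓ lam φ R)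
    (hA : Continuous Avec) {j : ℤ} (hj : (ℓ : ℤ) ≤ |j|) (r r' θ θ' : ℝ) :
    radialFactor (lam j) (r * r') * φ j (pt θ) * conj (φ j (pt θ'))
      = ((1 / (2 * Real.pi) : ℝ) : ℂ)
        * Complex.exp (-Complex.I * ((∫ s in θ'..θ, angularComponent Avec s : ℝ) : ℂ))
        * Complex.exp (-Complex.I * (((⌊avgA Avec + 1 / 2⌋ : ℝ) * (θ - θ') : ℝ) : ℂ))
        * highTerm Avec lam R r r' θ θ' j := by
  have hint := (continuous_angularComponent hA).intervalIntegrable (μ := MeasureTheory.volume)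
  have hscale : ((1 / (2 * Real.pi) : ℝ) : ℂ)
      = ((1 / √(2 * Real.pi) : ℝ) : ℂ) * ((1 / √(2 * Real.pi) : ℝ) : ℂ) := by
    rw [← Complex.ofReal_mul, div_mul_div_comm, one_mul, Real.mul_self_sqrt (by positivity)]
  rw [H.eigen_eq j hj θ, H.eigen_eq j hj θ', highTerm_eq, hscale,
    ← intervalIntegral.integral_interval_sub_left (hint 0 θ) (hint 0 θ'),
    mul_assoc (_ * _) (Complex.exp _) (Complex.exp _), ← exp_mul_conj_exp_eq, map_mul, map_mul,
    Complex.conj_ofReal]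
  ring

theorem exists_equiv (H : IsHighSpectrum Avec a μ kstar ℓ lam φ R) :
    ∃ e : {k : ℕ // k ∉ Finset.range kstar} ≃ {j : ℤ // (ℓ : ℤ) ≤ |j|},
      ∀ k : {k : ℕ // k ∉ Finset.range kstar}, μ k = lam (e k) := by
  let eIndex : {k : ℕ // k ∉ Finset.range kstar} ≃ {k : ℕ | kstar ≤ k} :=
    Equiv.subtypeEquivRight fun k => by
      rw [Finset.mem_range, not_lt, Set.mem_ofPred_eq]
  let eMu := Equiv.Set.imageOfInjOn μ _ H.injOn_mu
  let eLam := Equiv.Set.imageOfInjOn lam _ H.injOn_lam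
  refine ⟨((eIndex.trans eMu).trans (Equiv.setCongr H.image_eq)).trans eLam.symm, fun k => ?_⟩
  exact congrArg Subtype.val
    (eLam.apply_symm_apply (Equiv.setCongr H.image_eq (eMu (eIndex k)))).symm

theorem kernelK_eq (H : IsHighSpectrum Avec a μ kstar ℓ lam φ R) (hA : Continuous Avec)
    (hμ : ∀ k, 0 < μ k) {ψ : ℕ → UnitCircle → ℂ}
    (hψ : ∀ k, kstar ≤ k → ∀ j : ℤ, (ℓ : ℤ) ≤ |j| → μ k = lam j → ψ k = φ j)
    {r r' : ℝ} (hr : 0 ≤ r) (hr' : 0 ≤ r') (θ θ' : ℝ) :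
    Summable (kernelTerm μ ψ (r • (pt θ : Plane)) (r' • (pt θ' : Plane))) ∧
    Summable (fun j : {j : ℤ // (ℓ : ℤ) ≤ |j|} => highTerm Avec lam R r r' θ θ' j) ∧
    kernelK μ ψ (r • (pt θ : Plane)) (r' • (pt θ' : Plane)) =
      ∑ k ∈ Finset.range kstar, radialFactor (μ k) (r * r') * ψ k (pt θ) * conj (ψ k (pt θ'))
      + ((1 / (2 * Real.pi) : ℝ) : ℂ)
        * Complex.exp (-Complex.I * ((∫ s in θ'..θ, angularComponent Avec s : ℝ) : ℂ))
        * Complex.exp (-Complex.I * (((⌊avgA Avec + 1 / 2⌋ : ℝ) * (θ - θ') : ℝ) : ℂ))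
        * ∑' j : {j : ℤ // (ℓ : ℤ) ≤ |j|}, highTerm Avec lam R r r' θ θ' j := by
  have hhigh : Summable fun j : {j : ℤ // (ℓ : ℤ) ≤ |j|} => highTerm Avec lam R r r' θ θ' j :=
    (H.summable_highTerm hr hr' θ θ').subtype _
  obtain ⟨e, he⟩ := H.exists_equiv
  set c : ℂ := ((1 / (2 * Real.pi) : ℝ) : ℂ)
    * Complex.exp (-Complex.I * ((∫ s in θ'..θ, angularComponent Avec s : ℝ) : ℂ))
    * Complex.exp (-Complex.I * (((⌊avgA Avec + 1 / 2⌋ : ℝ) * (θ - θ') : ℝ) : ℂ))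
  set f := kernelTerm μ ψ (r • (pt θ : Plane)) (r' • (pt θ' : Plane)) with hf_def
  have hterm (k : {k : ℕ // k ∉ Finset.range kstar}) :
      f k = c * highTerm Avec lam R r r' θ θ' (e k) := by
    have hk : kstar ≤ (k : ℕ) := not_lt.mp (Finset.mem_range.not.mp k.2)
    rw [hf_def, kernelTerm_smul_pt ψ hr hr' θ θ' (hμ k), hψ k hk (e k) (e k).2 (he k), he k]
    exact H.radialFactor_mul_conj_eq hA (e k).2 r r' θ θ'
  have htail : HasSum (fun k : {k : ℕ // k ∉ Finset.range kstar} => f k)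
      (c * ∑' j : {j : ℤ // (ℓ : ℤ) ≤ |j|}, highTerm Avec lam R r r' θ θ' j) := by
    simp only [hterm]
    exact (e.hasSum_iff (f := fun j : {j : ℤ // (ℓ : ℤ) ≤ |j|} =>
      c * highTerm Avec lam R r r' θ θ' j)).mpr (hhigh.hasSum.mul_left c)
  have hf : Summable f := (Finset.summable_compl_iff (Finset.range kstar)).mp htail.summable
  refine ⟨hf, hhigh, ?_⟩
  rw [kernelK, ← hf.sum_add_tsum_subtype_compl (Finset.range kstar), htail.tsum_eq]
  congr 1
  exact Finset.sum_congr rfl fun k _ => kernelTerm_smul_pt ψ hr hr' θ θ' (hμ k)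

end IsHighSpectrum

theorem abs_sub_floor_add_half_le (x : ℝ) : |x - ⌊x + 1 / 2⌋| ≤ 1 / 2 := by
  rw [abs_le]
  constructor <;> linarith [Int.floor_le (x + 1 / 2), Int.lt_floor_add_one (x + 1 / 2)]

theorem corollary2p1_general {Avec : UnitCircle → Plane} {a : UnitCircle → ℝ}
    (hA : Continuous Avec) (ha : Continuous a)
    (hdecay : ∃ B : ℝ, ∀ m : ℤ, |(m : ℝ)| * ‖circleCoeff m (circlePotential a ha)‖ ≤ B)
    (hres : ∀ m : ℤ, avgA Avec ≠ (m : ℝ) / 2) :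
    ∃ μ : ℕ → ℝ, IsEigenvalueSequence Avec a μ ∧
      (∃ (kstar ℓ : ℕ) (lam : ℤ → ℝ) (φ : ℤ → UnitCircle → ℂ) (R : ℤ → ℝ → ℂ),
        IsHighSpectrum Avec a μ kstar ℓ lam φ R) ∧
      (0 < μ 0 →
        ∀ (kstar ℓ : ℕ) (lam : ℤ → ℝ) (φ : ℤ → UnitCircle → ℂ) (R : ℤ → ℝ → ℂ),
          IsHighSpectrum Avec a μ kstar ℓ lam φ R →
        ∀ ψ : ℕ → UnitCircle → ℂ,
          (∀ k < kstar, IsNormalizedEigenfunction Avec a (μ k) (ψ k)) →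
          (∀ k, kstar ≤ k → ∀ j : ℤ, (ℓ : ℤ) ≤ |j| → μ k = lam j → ψ k = φ j) →
        ∀ (r r' θ θ' : ℝ), 0 ≤ r → 0 ≤ r' →
        ∀ (x y : Plane), x = r • (pt θ : Plane) → y = r' • (pt θ' : Plane) →
          Summable (kernelTerm μ ψ x y) ∧
          Summable (fun j : {j : ℤ // (ℓ : ℤ) ≤ |j|} => highTerm Avec lam R r r' θ θ' j) ∧
          kernelK μ ψ x y =
            ∑ k ∈ Finset.range kstar,
              radialFactor (μ k) (r * r') * ψ k (pt θ) * conj (ψ k (pt θ'))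
            + ((1 / (2 * Real.pi) : ℝ) : ℂ)
              * Complex.exp (-Complex.I * ((∫ s in θ'..θ, angularComponent Avec s : ℝ) : ℂ))
              * Complex.exp (-Complex.I * (((⌊avgA Avec + 1 / 2⌋ : ℝ) * (θ - θ') : ℝ) : ℂ))
              * ∑' j : {j : ℤ // (ℓ : ℤ) ≤ |j|}, highTerm Avec lam R r r' θ θ' j) := by
  have hnonres (m : ℤ) : 2 * (avgA Avec - ⌊avgA Avec + 1 / 2⌋) ≠ m := fun h =>
    hres (2 * ⌊avgA Avec + 1 / 2⌋ + m) (by push_cast; linarith)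
  obtain ⟨κ, hκ⟩ := exists_isNonresonant (abs_sub_floor_add_half_le (avgA Avec)) hnonres
  obtain ⟨μ, hμ, hhigh⟩ := exists_isHighSpectrum hA ha hdecay rfl hκ
  refine ⟨μ, hμ, hhigh, ?_⟩
  rintro hpos kstar ℓ lam φ R H ψ - hψ r r' θ θ' hr hr' x y rfl rfl
  exact H.kernelK_eq hA (fun k => hpos.trans_le (hμ.mono (Nat.zero_le k))) hψ hr hr' θ θ'

end

theorem corollary2p1
    (Avec : UnitCircle → Plane) (a : UnitCircle → ℝ)
    -- Lipschitz continuity, that is, `W^{1,∞}` on the circle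
    (hA : ∃ C, LipschitzWith C Avec) (ha : ∃ C, LipschitzWith C a)
    -- transversality
    (htrans : ∀ ω : UnitCircle, inner ℝ (Avec ω) (ω : Plane) = 0)
    -- the circulation is neither an integer nor a half-integer
    (hres : ∀ m : ℤ, avgA Avec ≠ (m : ℝ) / 2) :
    ∃ μ : ℕ → ℝ, IsEigenvalueSequence Avec a μ ∧
      (∃ (kstar ℓ : ℕ) (lam : ℤ → ℝ) (φ : ℤ → UnitCircle → ℂ) (R : ℤ → ℝ → ℂ),
        IsHighSpectrum Avec a μ kstar ℓ lam φ R) ∧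
      (0 < μ 0 →
        ∀ (kstar ℓ : ℕ) (lam : ℤ → ℝ) (φ : ℤ → UnitCircle → ℂ) (R : ℤ → ℝ → ℂ),
          IsHighSpectrum Avec a μ kstar ℓ lam φ R →
        ∀ ψ : ℕ → UnitCircle → ℂ,
          (∀ k < kstar, IsNormalizedEigenfunction Avec a (μ k) (ψ k)) →
          (∀ k, kstar ≤ k → ∀ j : ℤ, (ℓ : ℤ) ≤ |j| → μ k = lam j → ψ k = φ j) →
        ∀ (r r' θ θ' : ℝ), 0 ≤ r → 0 ≤ r' →
        ∀ (x y : Plane), x = r • (pt θ : Plane) → y = r' • (pt θ' : Plane) →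
          Summable (kernelTerm μ ψ x y) ∧
          Summable (fun j : {j : ℤ // (ℓ : ℤ) ≤ |j|} => highTerm Avec lam R r r' θ θ' j) ∧
          kernelK μ ψ x y =
            ∑ k ∈ Finset.range kstar,
              radialFactor (μ k) (r * r') * ψ k (pt θ) * conj (ψ k (pt θ'))
            + ((1 / (2 * Real.pi) : ℝ) : ℂ)
              * Complex.exp (-Complex.I * ((∫ s in θ'..θ, angularComponent Avec s : ℝ) : ℂ))
              * Complex.exp (-Complex.I * (((⌊avgA Avec + 1 / 2⌋ : ℝ) * (θ - θ') : ℝ) : ℂ))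
              * ∑' j : {j : ℤ // (ℓ : ℤ) ≤ |j|}, highTerm Avec lam R r r' θ θ' j) := by
  exact corollary2p1_general hA.choose_spec.continuous ha.choose_spec.continuous
    (exists_abs_mul_norm_circleCoeff_circlePotential_le ha.choose_spec) hres
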